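/- Let $V$ be a finite-dimensional complex vector space with a symplectic form $\omega$ (a nondegenerate alternating bilinear form), and let $G$ be a finite group acting linearly on $V$ and preserving $\omega$. Let $S\subset G$ be the set of symplectic reflections, i.e. the elements $s$ for which $1-s$ has rank $2$ on $V$; for $s\in S$ let $\omega_s(x,y)$ be $\omega$ applied to the projections of $x,y\in V$ to $\operatorname{Im}(1-s)$ along $\operatorname{Ker}(1-s)$. Let $\mathbb C[S]^G$ be the space of functions $S\to\mathbb C$ invariant under conjugation by $G$, let $b_1,\dots,b_\ell$ be a basis of it, put $K=\mathbb C[[\hbar_1,\dots,\hbar_\ell]]$ with maximal ideal $\mathfrak m$, and let $c_s=\sum_{i=1}^{\ell}\hbar_i\,b_i(s)\in K$ for $s\in S$ (so $c$ is a formal parameter ranging over $\mathbb C[S]^G$). Let $\mathrm{Weyl}(V)$ be the quotient of the tensor algebra $T(V)$ by the two-sided ideal generated by $xy-yx-\omega(x,y)$, $x,y\in V$. Let $H_c(V,G)$ be the quotient of $(G\ltimes T(V))[[\hbar_1,\dots,\hbar_\ell]]$ by the $\mathfrak m$-adically closed two-sided ideal generated by the relations $$xy-yx=\omega(x,y)-2\sum_{s\in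 S}c_s\,\omega_s(x,y)\,s,\qquad x,y\in V .$$ Then $H_c(V,G)$ is a flat formal deformation of $G\ltimes\mathrm{Weyl}(V)$ over $K$: it is topologically free as a $K$-module, i.e. isomorphic as a $K$-module to $M_0[[\hbar_1,\dots,\hbar_\ell]]$ for some complex vector space $M_0$, and there is an isomorphism of $\mathbb C$-algebras $H_c(V,G)/\mathfrak m H_c(V,G)\cong G\ltimes\mathrm{Weyl}(V)$, which can be taken to send the class of every $x\in V$ to $x$ and the class of every $g\in G$ to $g$. -/

import Mathlib

noncomputable section

namespace FormalDeformation

/-! ### Formal power series in `ℓ` variables and flat formal deformations -/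

/-- The ring `K = k[[ħ₁, …, ħ_ℓ]]`. -/
abbrev FormalRing (k : Type*) (ℓ : ℕ) : Type _ := MvPowerSeries (Fin ℓ) k

/-- The space `M[[ħ₁, …, ħ_ℓ]]` of formal power series with coefficients in a vector space `M`:
the value at `n` is the coefficient of `ħ^n`. -/
def FormalSeries (ℓ : ℕ) (M : Type*) : Type _ := (Fin ℓ →₀ ℕ) → M

namespace FormalSeries

variable {k : Type*} [Field k] {ℓ : ℕ} {M : Type*} [AddCommGroup M] [Module k M]

instance : AddCommGroup (FormalSeries ℓ M) :=
  inferInstanceAs (AddCommGroup ((Fin ℓ →₀ ℕ) → M))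

/-- The coefficient of `ħ^n`. -/
def coeff {ℓ : ℕ} {M : Type*} (n : Fin ℓ →₀ ℕ) (m : FormalSeries ℓ M) : M := m n

theorem ext_coeff {ℓ : ℕ} {M : Type*} {m m' : FormalSeries ℓ M} (h : ∀ n, coeff n m = coeff n m') : m = m' :=
  funext h

theorem coeff_add (n : Fin ℓ →₀ ℕ) (m m' : FormalSeries ℓ M) :
    coeff n (m + m') = coeff n m + coeff n m' := rfl

theorem coeff_zero (n : Fin ℓ →₀ ℕ) : coeff n (0 : FormalSeries ℓ M) = 0 := rfl

/-- The action of power series with scalar coefficients, by the Cauchy product. -/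
instance : SMul (FormalRing k ℓ) (FormalSeries ℓ M) where
  smul f m := fun n =>
    ∑ p ∈ Finset.HasAntidiagonal.antidiagonal n, MvPowerSeries.coeff p.1 f • coeff p.2 m

theorem coeff_smul (n : Fin ℓ →₀ ℕ) (f : FormalRing k ℓ) (m : FormalSeries ℓ M) :
    coeff n (f • m) =
      ∑ p ∈ Finset.HasAntidiagonal.antidiagonal n, MvPowerSeries.coeff p.1 f • coeff p.2 m := rfl

/-- `M[[ħ₁, …, ħ_ℓ]]` is a module over `K`. -/
instance : Module (FormalRing k ℓ) (FormalSeries ℓ M) where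
  one_smul m := by
    classical
    refine ext_coeff fun n => ?_
    rw [coeff_smul, Finset.sum_eq_single (0, n)]
    · simp
    · rintro ⟨a, b⟩ hab hne
      have ha : a ≠ 0 := by
        rintro rfl
        simp at hab
        exact hne (by simp [hab])
      simp [MvPowerSeries.coeff_one, ha]
    · simp
  mul_smul f g m := by
    classical
    refine ext_coeff fun n => ?_
    simp only [coeff_smul, MvPowerSeries.coeff_mul, Finset.sum_smul, Finset.smul_sum, mul_smul]
    rw [Finset.sum_sigma', Finset.sum_sigma']
    refine Finset.sum_nbij' (fun ⟨⟨_, j⟩, ⟨k, l⟩⟩ => ⟨(k, l + j), (l, j)⟩)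
      (fun ⟨⟨i, _⟩, ⟨k, l⟩⟩ => ⟨(i + k, l), (i, k)⟩) ?_ ?_ ?_ ?_ ?_
    · rintro ⟨⟨a, b⟩, ⟨c, d⟩⟩ h
      simp only [Finset.mem_sigma, Finset.HasAntidiagonal.mem_antidiagonal] at h ⊢
      exact ⟨by rw [← add_assoc, h.2, h.1], trivial⟩
    · rintro ⟨⟨a, b⟩, ⟨c, d⟩⟩ h
      simp only [Finset.mem_sigma, Finset.HasAntidiagonal.mem_antidiagonal] at h ⊢
      exact ⟨by rw [add_assoc, h.2, h.1], trivial⟩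
    · rintro ⟨⟨a, b⟩, ⟨c, d⟩⟩ h
      simp only [Finset.mem_sigma, Finset.HasAntidiagonal.mem_antidiagonal] at h
      simp [h.2]
    · rintro ⟨⟨a, b⟩, ⟨c, d⟩⟩ h
      simp only [Finset.mem_sigma, Finset.HasAntidiagonal.mem_antidiagonal] at h
      simp [h.2]
    · rintro ⟨⟨a, b⟩, ⟨c, d⟩⟩ h
      rfl
  smul_zero f := ext_coeff fun n => by simp [coeff_smul, coeff_zero]
  smul_add f m m' := ext_coeff fun n => by
    simp [coeff_smul, coeff_add, smul_add, Finset.sum_add_distrib]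
  add_smul f g m := ext_coeff fun n => by
    simp [coeff_smul, coeff_add, add_smul, Finset.sum_add_distrib]
  zero_smul m := ext_coeff fun n => by simp [coeff_smul, coeff_zero]

end FormalSeries

/-- A `K`-module is topologically free if it is isomorphic to `M₀[[ħ₁, …, ħ_ℓ]]` for some
vector space `M₀`. -/
def IsTopologicallyFree.{u, v} (k : Type u) [Field k] (ℓ : ℕ) (M : Type v) [AddCommGroup M]
    [Module (FormalRing k ℓ) M] : Prop :=
  ∃ (M₀ : Type v) (_ : AddCommGroup M₀) (_ : Module k M₀),
    Nonempty (M ≃ₗ[FormalRing k ℓ] FormalSeries ℓ M₀)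

/-- The ideal `𝔪 A` of a `K`-algebra `A`, where `𝔪` is the maximal ideal of `K`. -/
abbrev maxIdeal (k : Type*) [Field k] (ℓ : ℕ) (A : Type*) [Ring A] [Algebra (FormalRing k ℓ) A] :
    Ideal A :=
  (IsLocalRing.maximalIdeal (FormalRing k ℓ)).map (algebraMap (FormalRing k ℓ) A)

instance maxIdeal_isTwoSided (k : Type*) [Field k] (ℓ : ℕ) (A : Type*) [Ring A]
    [Algebra (FormalRing k ℓ) A] : (maxIdeal k ℓ A).IsTwoSided where
  mul_mem_of_left {a} b ha := by
    induction ha using Submodule.span_induction with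
    | mem x hx =>
      obtain ⟨r, hr, rfl⟩ := hx
      rw [Algebra.commutes]
      exact Ideal.mul_mem_left _ _ (Ideal.mem_map_of_mem _ hr)
    | zero => simp
    | add x y _ _ hx hy => rw [add_mul]; exact Ideal.add_mem _ hx hy
    | smul r x _ hx => rw [smul_eq_mul, mul_assoc]; exact Ideal.mul_mem_left _ _ hx

/-- The data of an `ℓ`-parameter flat formal deformation of the `k`-algebra `A₀` on the
`K`-algebra `A`: `A` is topologically free over `K`, and `φ` is an isomorphism of `k`-algebras
from `A / 𝔪 A` to `A₀` (the `k`-algebra structure of `A / 𝔪 A` comes from `k ⊆ K`). -/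
structure FlatFormalDeformation (k : Type*) [Field k] (ℓ : ℕ) (A₀ : Type*) [Ring A₀]
    [Algebra k A₀] (A : Type*) [Ring A] [Algebra (FormalRing k ℓ) A] where
  topologicallyFree : IsTopologicallyFree k ℓ A
  φ : (A ⧸ maxIdeal k ℓ A) ≃+* A₀
  φ_algebraMap : ∀ z : k,
    φ (Ideal.Quotient.mk _ (algebraMap (FormalRing k ℓ) A (MvPowerSeries.C z))) =
      algebraMap k A₀ z

/-- For a (noncommutative) `k`-algebra `F`, the ring `F[[ħ₁, …, ħ_ℓ]]` with central variables is
an algebra over `K`. -/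
instance formalAlgebra (k : Type*) [Field k] (ℓ : ℕ) (F : Type*) [Ring F] [Algebra k F] :
    Algebra (FormalRing k ℓ) (MvPowerSeries (Fin ℓ) F) :=
  (MvPowerSeries.map (algebraMap k F)).toAlgebra' (by
    classical
    intro c x
    ext n
    rw [MvPowerSeries.coeff_mul, MvPowerSeries.coeff_mul]
    refine Finset.sum_nbij' Prod.swap Prod.swap ?_ ?_ ?_ ?_ ?_
    · simp [add_comm]
    · simp [add_comm]
    · simp
    · simp
    · simp [Algebra.commutes])

/-- A two-sided ideal of `F[[ħ₁, …, ħ_ℓ]]` is closed in the adic topology if it contains every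
series that it approximates to every order, i.e. up to series without terms of degree less
than `N`, for every `N`. -/
def IsAdicallyClosed {ℓ : ℕ} {F : Type*} [Ring F]
    (J : TwoSidedIdeal (MvPowerSeries (Fin ℓ) F)) : Prop :=
  ∀ x : MvPowerSeries (Fin ℓ) F,
    (∀ N : ℕ, ∃ y ∈ J, ∀ n : Fin ℓ →₀ ℕ, n.degree < N →
      MvPowerSeries.coeff n x = MvPowerSeries.coeff n y) → x ∈ J

/-- The adically closed two-sided ideal generated by a set of relations. -/
def closedIdeal {ℓ : ℕ} {F : Type*} [Ring F] (rels : Set (MvPowerSeries (Fin ℓ) F)) :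
    TwoSidedIdeal (MvPowerSeries (Fin ℓ) F) :=
  sInf {J | rels ⊆ (J : Set (MvPowerSeries (Fin ℓ) F)) ∧ IsAdicallyClosed J}

end FormalDeformation

namespace SymplecticReflection

open FormalDeformation

/-! ### Linear actions, the Weyl algebra, and semidirect products -/

section Action

variable (G : Type*) {V : Type*} [Group G] [AddCommGroup V] [Module ℂ V]
  [DistribMulAction G V] [SMulCommClass G ℂ V]

/-- The linear operator by which `g` acts on `V`. -/
abbrev act {G : Type*} (V : Type*) [Group G] [AddCommGroup V] [Module ℂ V]
    [DistribMulAction G V] [SMulCommClass G ℂ V] (g : G) : V →ₗ[ℂ] V :=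
  DistribSMul.toLinearMap ℂ V g

/-- The automorphism of the tensor algebra induced by `g`. -/
def tensorMap {G : Type*} (V : Type*) [Group G] [AddCommGroup V] [Module ℂ V]
    [DistribMulAction G V] [SMulCommClass G ℂ V] (g : G) :
    TensorAlgebra ℂ V →ₐ[ℂ] TensorAlgebra ℂ V :=
  TensorAlgebra.lift ℂ (TensorAlgebra.ι ℂ ∘ₗ act V g)

/-- `G` acts on the tensor algebra `T(V)` by algebra automorphisms. -/
instance tensorAction : MulSemiringAction G (TensorAlgebra ℂ V) where
  smul g a := tensorMap V g a
  one_smul a := by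
    change tensorMap V (1 : G) a = a
    have : tensorMap V (1 : G) = AlgHom.id ℂ _ := by
      ext v; simp [tensorMap]
    rw [this]; rfl
  mul_smul g h a := by
    change tensorMap V (g * h) a = tensorMap V g (tensorMap V h a)
    have : tensorMap V (g * h) = (tensorMap V g).comp (tensorMap V h) := by
      ext v; simp [tensorMap, mul_smul]
    rw [this]; rfl
  smul_zero g := map_zero (tensorMap V g)
  smul_add g := map_add (tensorMap V g)
  smul_one g := map_one (tensorMap V g)
  smul_mul g := map_mul (tensorMap V g)

theorem smul_tensor_def (g : G) (a : TensorAlgebra ℂ V) : g • a = tensorMap V g a := rfl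

instance : SMulCommClass G ℂ (TensorAlgebra ℂ V) where
  smul_comm g z a := map_smul (tensorMap V g) z a

/-- The action of `G` preserves the bilinear form `ω`. -/
class PreservesForm (ω : LinearMap.BilinForm ℂ V) : Prop where
  apply_smul_smul : ∀ (g : G) (x y : V), ω (g • x) (g • y) = ω x y

/-- The defining relations `x y - y x = ω(x, y)` of the Weyl algebra. -/
inductive WeylRel {V : Type*} [AddCommGroup V] [Module ℂ V] (ω : LinearMap.BilinForm ℂ V) :
    TensorAlgebra ℂ V → TensorAlgebra ℂ V → Prop
  | comm (x y : V) : WeylRel ω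
      (TensorAlgebra.ι ℂ x * TensorAlgebra.ι ℂ y - TensorAlgebra.ι ℂ y * TensorAlgebra.ι ℂ x)
      (algebraMap ℂ _ (ω x y))

/-- The Weyl algebra of `(V, ω)`. -/
abbrev Weyl {V : Type*} [AddCommGroup V] [Module ℂ V] (ω : LinearMap.BilinForm ℂ V) : Type _ :=
  RingQuot (WeylRel ω)

/-- The quotient map `T(V) → Weyl(V)`. -/
abbrev Weyl.mk {V : Type*} [AddCommGroup V] [Module ℂ V] (ω : LinearMap.BilinForm ℂ V) :
    TensorAlgebra ℂ V →ₐ[ℂ] Weyl ω :=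
  RingQuot.mkAlgHom ℂ (WeylRel ω)

/-- The automorphism of the Weyl algebra induced by `g`. -/
def weylMap {G : Type*} {V : Type*} [Group G] [AddCommGroup V] [Module ℂ V]
    [DistribMulAction G V] [SMulCommClass G ℂ V] (ω : LinearMap.BilinForm ℂ V)
    [PreservesForm G ω] (g : G) : Weyl ω →ₐ[ℂ] Weyl ω :=
  RingQuot.liftAlgHom ℂ ⟨(Weyl.mk ω).comp (tensorMap V g), by
    rintro _ _ ⟨x, y⟩
    have h := RingQuot.mkAlgHom_rel ℂ (WeylRel.comm (ω := ω) (g • x) (g • y))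
    rw [PreservesForm.apply_smul_smul] at h
    simpa [tensorMap] using h⟩

theorem weylMap_mk (ω : LinearMap.BilinForm ℂ V) [PreservesForm G ω] (g : G)
    (a : TensorAlgebra ℂ V) : weylMap ω g (Weyl.mk ω a) = Weyl.mk ω (g • a) := by
  simp [weylMap, smul_tensor_def]

/-- `G` acts on the Weyl algebra by algebra automorphisms. -/
instance weylAction (ω : LinearMap.BilinForm ℂ V) [PreservesForm G ω] :
    MulSemiringAction G (Weyl ω) where
  smul g a := weylMap ω g a
  one_smul a := by
    change weylMap ω (1 : G) a = a
    obtain ⟨a, rfl⟩ := RingQuot.mkAlgHom_surjective ℂ (WeylRel ω) a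
    rw [weylMap_mk, one_smul]
  mul_smul g h a := by
    change weylMap ω (g * h) a = weylMap ω g (weylMap ω h a)
    obtain ⟨a, rfl⟩ := RingQuot.mkAlgHom_surjective ℂ (WeylRel ω) a
    rw [weylMap_mk, weylMap_mk, weylMap_mk, mul_smul]
  smul_zero g := map_zero (weylMap ω g)
  smul_add g := map_add (weylMap ω g)
  smul_one g := map_one (weylMap ω g)
  smul_mul g := map_mul (weylMap ω g)

instance (ω : LinearMap.BilinForm ℂ V) [PreservesForm G ω] : SMulCommClass G ℂ (Weyl ω) where
  smul_comm g z a := map_smul (weylMap ω g) z a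

/-- The semidirect product `G ⋉ T(V)`; its elements are finite sums of `a g` with `a ∈ T(V)`,
`g ∈ G`, and `g a = (g • a) g`. -/
abbrev SmashTensor (V : Type*) [AddCommGroup V] [Module ℂ V] [DistribMulAction G V]
    [SMulCommClass G ℂ V] : Type _ :=
  SkewMonoidAlgebra (TensorAlgebra ℂ V) G

/-- The semidirect product `G ⋉ Weyl(V)`. -/
abbrev SmashWeyl (ω : LinearMap.BilinForm ℂ V) [PreservesForm G ω] : Type _ :=
  SkewMonoidAlgebra (Weyl ω) G

end Action

/-! ### Symplectic reflections -/

section Reflections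

variable (G : Type*) (V : Type*) [Group G] [AddCommGroup V] [Module ℂ V]
  [DistribMulAction G V] [SMulCommClass G ℂ V]

/-- The set `S` of symplectic reflections: the `g ∈ G` for which `1 - g` has rank `2` on `V`. -/
def reflections : Set G :=
  {g | Module.finrank ℂ (LinearMap.range (1 - act V g)) = 2}

/-- The space `ℂ[S]^G` of conjugation-invariant functions on `S`. -/
def invariantFunctions : Submodule ℂ (reflections G V → ℂ) where
  carrier := {f | ∀ (g : G) (s s' : reflections G V), (s' : G) = g * s * g⁻¹ → f s' = f s}
  add_mem' hf hf' g s s' h := by simp [hf g s s' h, hf' g s s' h]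
  zero_mem' _ _ _ _ := rfl
  smul_mem' z f hf g s s' h := by simp [hf g s s' h]

variable {G} in
theorem isCompl_range_ker [Finite G] [FiniteDimensional ℂ V] (g : G) :
    IsCompl (LinearMap.range (1 - act V g)) (LinearMap.ker (1 - act V g)) := by
  refine (Submodule.isCompl_iff_disjoint _ _ ?_).mpr ?_
  · rw [LinearMap.finrank_range_add_finrank_ker]
  · rw [Submodule.disjoint_def]
    rintro x ⟨y, hy⟩ hx
    have hx' : g • x = x := by
      have : x - g • x = 0 := by simpa using hx
      exact (sub_eq_zero.mp this).symm
    have hy' : g • y = y - x := by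
      have : y - g • y = x := by simpa using hy
      rw [← this]; abel
    have key : ∀ m : ℕ, g ^ m • y = y - (m : ℂ) • x := by
      intro m
      induction m with
      | zero => simp
      | succ m ih =>
        rw [pow_succ', mul_smul, ih, smul_sub, smul_comm g, hx', hy']
        push_cast
        rw [add_smul, one_smul]
        abel
    have h := key (orderOf g)
    rw [pow_orderOf_eq_one, one_smul] at h
    have h0 : (orderOf g : ℂ) • x = 0 := by simpa using h.symm
    have hpos : (orderOf g : ℂ) ≠ 0 := by exact_mod_cast (orderOf_pos g).ne'
    exact (smul_eq_zero.mp h0).resolve_left hpos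

variable {G V} in
/-- The form `ω_s`: the form `ω` applied to the projections of both arguments to the image of
`1 - s` along the kernel of `1 - s`. -/
def reflForm [Finite G] [FiniteDimensional ℂ V] (ω : LinearMap.BilinForm ℂ V) (s : G) (x y : V) :
    ℂ :=
  ω (Submodule.projection _ _ (isCompl_range_ker V s) x)
    (Submodule.projection _ _ (isCompl_range_ker V s) y)

instance [Finite G] : Fintype (reflections G V) := Fintype.ofFinite _

end Reflections

/-! ### The symplectic reflection algebra with formal parameter -/

section Algebra

variable {G V : Type*} [Group G] [AddCommGroup V] [Module ℂ V]
  [DistribMulAction G V] [SMulCommClass G ℂ V] {ℓ : ℕ}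

/-- The formal parameter `c` ranging over `ℂ[S]^G`: for a basis `b₁, …, b_ℓ` of `ℂ[S]^G`, with
`ħ₁, …, ħ_ℓ` as the corresponding coordinates, this is `c = ħ₁ b₁ + ⋯ + ħ_ℓ b_ℓ`. -/
def formalParam (b : Module.Basis (Fin ℓ) ℂ (invariantFunctions G V)) (s : reflections G V) :
    FormalRing ℂ ℓ :=
  ∑ i, (b i : reflections G V → ℂ) s • MvPowerSeries.X i

/-- The element of `(G ⋉ T(V))[[ħ₁, …, ħ_ℓ]]` given by a vector. -/
def vec (G : Type*) {V : Type*} [Group G] [AddCommGroup V] [Module ℂ V]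
    [DistribMulAction G V] [SMulCommClass G ℂ V] (ℓ : ℕ) (x : V) :
    MvPowerSeries (Fin ℓ) (SmashTensor G V) :=
  MvPowerSeries.C (SkewMonoidAlgebra.single 1 (TensorAlgebra.ι ℂ x))

/-- The element of `(G ⋉ T(V))[[ħ₁, …, ħ_ℓ]]` given by a group element. -/
def grp {G : Type*} (V : Type*) [Group G] [AddCommGroup V] [Module ℂ V]
    [DistribMulAction G V] [SMulCommClass G ℂ V] (ℓ : ℕ) (g : G) :
    MvPowerSeries (Fin ℓ) (SmashTensor G V) :=
  MvPowerSeries.C (SkewMonoidAlgebra.single g 1)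

variable [Finite G] [FiniteDimensional ℂ V]

/-- The right-hand side `t ω(x, y) - 2 ∑_{s ∈ S} c_s ω_s(x, y) s` of the commutation relations,
for `t` and `c` with values in `K`. -/
def kappa (ω : LinearMap.BilinForm ℂ V) (t : FormalRing ℂ ℓ)
    (c : reflections G V → FormalRing ℂ ℓ) (x y : V) :
    MvPowerSeries (Fin ℓ) (SmashTensor G V) :=
  t • algebraMap ℂ (MvPowerSeries (Fin ℓ) (SmashTensor G V)) (ω x y)
    - 2 * ∑ s : reflections G V, c s • reflForm ω (s : G) x y • grp V ℓ (s : G)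

/-- The elements `[x, y] - κ(x, y)`, for `x, y ∈ V`. -/
def relations (ω : LinearMap.BilinForm ℂ V) (t : FormalRing ℂ ℓ)
    (c : reflections G V → FormalRing ℂ ℓ) : Set (MvPowerSeries (Fin ℓ) (SmashTensor G V)) :=
  Set.range fun p : V × V =>
    vec G ℓ p.1 * vec G ℓ p.2 - vec G ℓ p.2 * vec G ℓ p.1 - kappa ω t c p.1 p.2

/-- The symplectic reflection algebra `H_c(V, G)` with `t = 1` and formal parameter `c`: the
quotient of `(G ⋉ T(V))[[ħ₁, …, ħ_ℓ]]` by the closed ideal generated by the relations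
`[x, y] = ω(x, y) - 2 ∑_{s ∈ S} c_s ω_s(x, y) s`. -/
abbrev FormalSRA (ω : LinearMap.BilinForm ℂ V)
    (b : Module.Basis (Fin ℓ) ℂ (invariantFunctions G V)) : Type _ :=
  MvPowerSeries (Fin ℓ) (SmashTensor G V) ⧸
    (closedIdeal (relations ω 1 (formalParam b))).asIdeal

/-- The quotient map `(G ⋉ T(V))[[ħ₁, …, ħ_ℓ]] → H_c(V, G)`. -/
abbrev FormalSRA.mk (ω : LinearMap.BilinForm ℂ V)
    (b : Module.Basis (Fin ℓ) ℂ (invariantFunctions G V)) :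
    MvPowerSeries (Fin ℓ) (SmashTensor G V) →+* FormalSRA ω b :=
  Ideal.Quotient.mk _

end Algebra

end SymplecticReflection

end

/-!
The relations `x y = y x + κ(x, y)`, with `κ(x, y) = ∑ s, κ_s(x, y) s` in the group algebra, sort
the letters of a word in a basis of `V`, and can be read as rewriting rules for the values of a
linear map on `G ⋉ T(V)`. Comparing the possible sorting steps (a diamond lemma) shows that a linear
map that respects the relations exists, with prescribed values on the products of sorted words and
group elements, as soon as `κ` is alternating, `G`-equivariant and satisfies the Jacobi identity
`[κ(x, y), z] + [κ(y, z), x] + [κ(z, x), y] = 0`. For the relations of `H_c(V, G)` the Jacobi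
identity holds because `ω_s` only sees the plane `Im (1 - s)`, where any three vectors are
dependent.

The projection `π` of `G ⋉ T(V)` onto `G ⋉ Weyl(V)` respects the relations at `ħ = 0`. Lifting
its values on sorted words to constant series yields a map `θ` into `(G ⋉ Weyl(V))[[ħ]]` that
respects the relations over `K` and reduces to `π`. The `K`-linear extension of `θ` is onto by
successive approximation, and its kernel is the closed ideal of the relations: the kernel contains
the ideal by construction, and conversely the terms of an element of the kernel can be removed
degree by degree, because every element of the kernel of `π` is the constant term of an element of
the ideal. So `H_c(V, G)` is isomorphic to `(G ⋉ Weyl(V))[[ħ]]` as a `K`-module.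
-/

noncomputable section

namespace FormalDeformation

/-! ### Extension of linear maps to formal power series -/

theorem exists_forall_eq_of_wellFounded {α β : Type*} [Nonempty β] {r : α → α → Prop}
    (hr : WellFounded r) (Φ : (α → β) → α → β)
    (hΦ : ∀ f f' a, (∀ b, r b a → f b = f' b) → Φ f a = Φ f' a) :
    ∃ f : α → β, ∀ a, f a = Φ f a := by
  classical
  inhabit β
  let f : α → β := hr.fix fun a ih => Φ (fun b => if h : r b a then ih b h else default) a
  refine ⟨f, fun a => (hr.fix_eq _ a).trans (hΦ _ _ a fun b hb => ?_)⟩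
  rw [dif_pos hb]

open Finset.HasAntidiagonal

theorem snd_lt_of_mem_erase_antidiagonal {σ : Type*} [DecidableEq σ] {n : σ →₀ ℕ}
    {p : (σ →₀ ℕ) × (σ →₀ ℕ)} (hp : p ∈ (antidiagonal n).erase (0, n)) : p.2 < n := by
  obtain ⟨hne, hsum⟩ := Finset.mem_erase.mp hp
  rw [mem_antidiagonal] at hsum
  refine lt_of_le_of_ne (hsum ▸ le_add_self) fun h => hne (Prod.ext ?_ h)
  simpa [h] using hsum

namespace FormalSeries

variable {k : Type*} [Field k] {ℓ : ℕ} {M : Type*} [AddCommGroup M] [Module k M]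

instance : Module k (FormalSeries ℓ M) :=
  inferInstanceAs (Module k ((Fin ℓ →₀ ℕ) → M))

variable (k) in
/-- The coefficient of `ħ^n` as a linear map. -/
def coeffHom (n : Fin ℓ →₀ ℕ) : FormalSeries ℓ M →ₗ[k] M where
  toFun := coeff n
  map_add' := coeff_add n
  map_smul' _ _ := rfl

theorem coeff_constSMul (n : Fin ℓ →₀ ℕ) (z : k) (m : FormalSeries ℓ M) :
    coeff n (z • m) = z • coeff n m := rfl

theorem coeff_smul_eq_add (n : Fin ℓ →₀ ℕ) (f : FormalRing k ℓ) (m : FormalSeries ℓ M) :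
    coeff n (f • m) = MvPowerSeries.coeff 0 f • coeff n m +
      ∑ p ∈ (antidiagonal n).erase (0, n), MvPowerSeries.coeff p.1 f • coeff p.2 m := by
  rw [coeff_smul, ← Finset.add_sum_erase _ _ (a := (0, n)) (by simp)]

theorem coeffHom_zero_smul (f : FormalRing k ℓ) (m : FormalSeries ℓ M) :
    coeffHom k 0 (f • m) = MvPowerSeries.coeff 0 f • coeffHom k 0 m := by
  change coeff 0 (f • m) = MvPowerSeries.coeff 0 f • coeff 0 m
  simp [coeff_smul]

theorem C_smul (z : k) (m : FormalSeries ℓ M) :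
    (MvPowerSeries.C z : FormalRing k ℓ) • m = z • m := by
  classical
  refine ext_coeff fun n => ?_
  rw [coeff_smul_eq_add, Finset.sum_eq_zero, add_zero, coeff_constSMul]
  · simp
  · intro p hp
    have hp₁ : p.1 ≠ 0 := fun h => by
      obtain ⟨hne, hsum⟩ := Finset.mem_erase.mp hp
      exact hne (Prod.ext h (by simpa [h] using mem_antidiagonal.mp hsum))
    rw [MvPowerSeries.coeff_C, if_neg hp₁, zero_smul]

instance : IsScalarTower k (FormalRing k ℓ) (FormalSeries ℓ M) :=
  .of_algebraMap_smul fun z m => C_smul z m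

end FormalSeries

section Extend

variable {k : Type*} [Field k] {ℓ : ℕ} {F M : Type*} [Ring F] [Algebra k F]
  [AddCommGroup M] [Module k M]

instance : IsScalarTower k (FormalRing k ℓ) (MvPowerSeries (Fin ℓ) F) :=
  .of_algebraMap_eq fun z => by
    rw [MvPowerSeries.algebraMap_apply, MvPowerSeries.algebraMap_apply]
    exact (MvPowerSeries.map_C _ _).symm

theorem coeff_formalRing_smul (n : Fin ℓ →₀ ℕ) (f : FormalRing k ℓ)
    (x : MvPowerSeries (Fin ℓ) F) :
    MvPowerSeries.coeff n (f • x) =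
      ∑ p ∈ antidiagonal n, MvPowerSeries.coeff p.1 f • MvPowerSeries.coeff p.2 x := by
  classical
  rw [Algebra.smul_def, MvPowerSeries.coeff_mul]
  refine Finset.sum_congr rfl fun p _ => ?_
  rw [Algebra.smul_def]
  exact congrArg (· * _) (MvPowerSeries.coeff_map _ _ _)

/-- The continuous `K`-linear extension `F[[ħ₁, …, ħ_ℓ]] → M[[ħ₁, …, ħ_ℓ]]` of a linear map
`F → M[[ħ₁, …, ħ_ℓ]]`. -/
def extend (θ : F →ₗ[k] FormalSeries ℓ M) :
    MvPowerSeries (Fin ℓ) F →ₗ[FormalRing k ℓ] FormalSeries ℓ M where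
  toFun x n := ∑ p ∈ antidiagonal n, FormalSeries.coeff p.1 (θ (MvPowerSeries.coeff p.2 x))
  map_add' x y := FormalSeries.ext_coeff fun n =>
    (Finset.sum_congr rfl fun p _ => by
      rw [map_add, map_add, FormalSeries.coeff_add]).trans Finset.sum_add_distrib
  map_smul' f x := FormalSeries.ext_coeff fun n => by
    change ∑ p ∈ antidiagonal n, FormalSeries.coeffHom k p.1 (θ (MvPowerSeries.coeff p.2 (f • x))) =
      ∑ p ∈ antidiagonal n, MvPowerSeries.coeff p.1 f •
        ∑ q ∈ antidiagonal p.2, FormalSeries.coeffHom k q.1 (θ (MvPowerSeries.coeff q.2 x))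
    simp only [coeff_formalRing_smul, map_sum, map_smul, Finset.smul_sum, Finset.sum_sigma']
    refine Finset.sum_nbij' (fun ⟨⟨a, _⟩, ⟨i, j⟩⟩ => ⟨(i, a + j), (a, j)⟩)
      (fun ⟨⟨i, _⟩, ⟨a, j⟩⟩ => ⟨(a, i + j), (i, j)⟩) ?_ ?_ ?_ ?_ ?_
    all_goals
      rintro ⟨⟨a, b⟩, ⟨c, d⟩⟩ h
      simp only [Finset.mem_sigma, mem_antidiagonal] at h ⊢
    · exact ⟨by rw [← h.1, ← h.2, add_left_comm], trivial⟩
    · exact ⟨by rw [← h.1, ← h.2, add_left_comm], trivial⟩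
    · rw [h.2]
    · rw [h.2]

variable (θ : F →ₗ[k] FormalSeries ℓ M)

theorem coeff_extend (n : Fin ℓ →₀ ℕ) (x : MvPowerSeries (Fin ℓ) F) :
    FormalSeries.coeff n (extend θ x) =
      ∑ p ∈ antidiagonal n, FormalSeries.coeff p.1 (θ (MvPowerSeries.coeff p.2 x)) := rfl

theorem coeff_extend_eq_add (n : Fin ℓ →₀ ℕ) (x : MvPowerSeries (Fin ℓ) F) :
    FormalSeries.coeff n (extend θ x) =
      FormalSeries.coeff 0 (θ (MvPowerSeries.coeff n x)) +
        ∑ p ∈ (antidiagonal n).erase (0, n),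
          FormalSeries.coeff p.1 (θ (MvPowerSeries.coeff p.2 x)) := by
  rw [coeff_extend, ← Finset.add_sum_erase _ _ (a := (0, n)) (by simp)]

theorem coeff_extend_eq_zero {n : Fin ℓ →₀ ℕ} {x : MvPowerSeries (Fin ℓ) F}
    (h : ∀ m ≤ n, MvPowerSeries.coeff m x = 0) : FormalSeries.coeff n (extend θ x) = 0 := by
  refine Finset.sum_eq_zero fun p hp => ?_
  rw [h p.2 (mem_antidiagonal.mp hp ▸ le_add_self), map_zero, FormalSeries.coeff_zero]

theorem extend_C (z : F) : extend θ (MvPowerSeries.C z) = θ z := by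
  classical
  refine FormalSeries.ext_coeff fun n => ?_
  rw [coeff_extend, Finset.sum_eq_single (n, 0)]
  · simp
  · intro p hp hne
    have hp₂ : p.2 ≠ 0 := fun h => hne (Prod.ext (by simpa [h] using mem_antidiagonal.mp hp) h)
    rw [MvPowerSeries.coeff_C, if_neg hp₂, map_zero, FormalSeries.coeff_zero]
  · simp

theorem coeff_mul_eq_zero {σ R : Type*} [Semiring R] {n : σ →₀ ℕ} {x : MvPowerSeries σ R}
    (h : ∀ m ≤ n, MvPowerSeries.coeff m x = 0) (u v : MvPowerSeries σ R) :
    ∀ m ≤ n, MvPowerSeries.coeff m (u * x * v) = 0 := by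
  classical
  intro m hm
  rw [MvPowerSeries.coeff_mul]
  refine Finset.sum_eq_zero fun p hp => ?_
  rw [MvPowerSeries.coeff_mul, Finset.sum_eq_zero, zero_mul]
  intro q hq
  rw [h, mul_zero]
  calc q.2 ≤ p.1 := mem_antidiagonal.mp hq ▸ le_add_self
    _ ≤ m := mem_antidiagonal.mp hp ▸ le_self_add
    _ ≤ n := hm

theorem smul_C_eq_monomial (n : Fin ℓ →₀ ℕ) (a : F) :
    (MvPowerSeries.monomial n (1 : k) : FormalRing k ℓ) • MvPowerSeries.C a =
      (MvPowerSeries.monomial n a : MvPowerSeries (Fin ℓ) F) := by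
  classical
  rw [Algebra.smul_def]
  ext m
  rw [MvPowerSeries.coeff_mul_C, MvPowerSeries.coeff_monomial]
  refine (congrArg (· * a) (MvPowerSeries.coeff_map _ _ _)).trans ?_
  rw [MvPowerSeries.coeff_monomial]
  split_ifs <;> simp

theorem eq_zero_of_forall_C {f : MvPowerSeries (Fin ℓ) F →ₗ[FormalRing k ℓ] FormalSeries ℓ M}
    (hf : ∀ n x, (∀ m ≤ n, MvPowerSeries.coeff m x = 0) → FormalSeries.coeff n (f x) = 0)
    (hC : ∀ a, f (MvPowerSeries.C a) = 0) (x : MvPowerSeries (Fin ℓ) F) : f x = 0 := by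
  classical
  refine FormalSeries.ext_coeff fun n => ?_
  let y := ∑ m ∈ Finset.Iic n, MvPowerSeries.monomial m (MvPowerSeries.coeff m x)
  have hy : f y = 0 := by
    rw [map_sum]
    refine Finset.sum_eq_zero fun m _ => ?_
    rw [← smul_C_eq_monomial (k := k), map_smul, hC, smul_zero]
  have hxy : ∀ m ≤ n, MvPowerSeries.coeff m (x - y) = 0 := fun m hm => by
    simp [y, MvPowerSeries.coeff_monomial, hm]
  rw [← sub_add_cancel x y, map_add, hy, add_zero, hf n _ hxy, FormalSeries.coeff_zero]

variable {θ}

theorem extend_mul_mul_eq_zero {r : MvPowerSeries (Fin ℓ) F}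
    (h : ∀ p q : F, extend θ (MvPowerSeries.C p * r * MvPowerSeries.C q) = 0)
    (u v : MvPowerSeries (Fin ℓ) F) : extend θ (u * r * v) = 0 := by
  have hleft (p : F) (v : MvPowerSeries (Fin ℓ) F) : extend θ (MvPowerSeries.C p * r * v) = 0 :=
    eq_zero_of_forall_C (f := extend θ ∘ₗ LinearMap.mulLeft _ (MvPowerSeries.C p * r))
      (fun n x hx => coeff_extend_eq_zero θ <| by
        simpa only [LinearMap.mulLeft_apply, mul_one] using
          coeff_mul_eq_zero hx (MvPowerSeries.C p * r) 1) (h p) v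
  exact eq_zero_of_forall_C (f := extend θ ∘ₗ LinearMap.mulRight _ v ∘ₗ LinearMap.mulRight _ r)
    (fun n x hx => coeff_extend_eq_zero θ <| by
      simpa [mul_assoc] using coeff_mul_eq_zero hx 1 (r * v)) (fun p => hleft p v) u

theorem subset_closedIdeal (rels : Set (MvPowerSeries (Fin ℓ) F)) :
    rels ⊆ (closedIdeal rels : Set (MvPowerSeries (Fin ℓ) F)) := fun _ hr =>
  (TwoSidedIdeal.mem_sInf _).mpr fun _ hJ => hJ.1 hr

theorem isAdicallyClosed_closedIdeal (rels : Set (MvPowerSeries (Fin ℓ) F)) :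
    IsAdicallyClosed (closedIdeal rels) := fun x hx =>
  (TwoSidedIdeal.mem_sInf _).mpr fun J hJ => hJ.2 x fun N =>
    let ⟨y, hy, hxy⟩ := hx N
    ⟨y, (TwoSidedIdeal.mem_sInf _).mp hy J hJ, hxy⟩

theorem extend_eq_zero_of_mem_closedIdeal {rels : Set (MvPowerSeries (Fin ℓ) F)}
    (h : ∀ r ∈ rels, ∀ p q : F, extend θ (MvPowerSeries.C p * r * MvPowerSeries.C q) = 0)
    {z : MvPowerSeries (Fin ℓ) F} (hz : z ∈ closedIdeal rels) : extend θ z = 0 := by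
  let J : TwoSidedIdeal (MvPowerSeries (Fin ℓ) F) :=
    .mk' {z | ∀ u v, extend θ (u * z * v) = 0} (by simp)
      (fun {x y} hx hy u v => by rw [mul_add, add_mul, map_add, hx, hy, add_zero])
      (fun {x} hx u v => by rw [mul_neg, neg_mul, map_neg, hx, neg_zero])
      (fun {x y} hy u v => by rw [← mul_assoc, hy])
      (fun {x y} hx u v => by rw [← mul_assoc, mul_assoc, hx])
  have mem_J {z} : z ∈ J ↔ ∀ u v, extend θ (u * z * v) = 0 := TwoSidedIdeal.mem_mk' ..
  have hclosed : IsAdicallyClosed J := fun x hx => mem_J.mpr fun u v => by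
    refine FormalSeries.ext_coeff fun n => ?_
    obtain ⟨y, hy, hxy⟩ := hx (n.degree + 1)
    have hdiff : ∀ m ≤ n, MvPowerSeries.coeff m (x - y) = 0 := fun m hm => by
      rw [map_sub, hxy m (Nat.lt_succ_of_le (Finsupp.degree_mono hm)), sub_self]
    rw [← sub_add_cancel x y, mul_add, add_mul, map_add, mem_J.mp hy, add_zero,
      coeff_extend_eq_zero θ (coeff_mul_eq_zero hdiff u v), FormalSeries.coeff_zero]
  have hzJ : z ∈ J := (TwoSidedIdeal.mem_sInf _).mp hz J
    ⟨fun r hr => mem_J.mpr (extend_mul_mul_eq_zero (h r hr)), hclosed⟩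
  simpa using mem_J.mp hzJ 1 1

variable {π : F →ₗ[k] M}

theorem extend_surjective (hθ : ∀ z, FormalSeries.coeff 0 (θ z) = π z)
    (hπ : Function.Surjective π) : Function.Surjective (extend θ) := by
  intro y
  choose lift hlift using hπ
  obtain ⟨(x : MvPowerSeries (Fin ℓ) F), hx⟩ :=
    exists_forall_eq_of_wellFounded (wellFounded_lt (α := Fin ℓ →₀ ℕ))
    (fun x n => lift (FormalSeries.coeff n y -
      ∑ p ∈ (antidiagonal n).erase (0, n), FormalSeries.coeff p.1 (θ (x p.2))))
    fun x x' n h => by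
      refine congrArg (fun t => lift (FormalSeries.coeff n y - t)) (Finset.sum_congr rfl ?_)
      exact fun p hp => by rw [h p.2 (snd_lt_of_mem_erase_antidiagonal hp)]
  refine ⟨x, FormalSeries.ext_coeff fun n => ?_⟩
  rw [coeff_extend_eq_add, hθ, show MvPowerSeries.coeff n x = _ from hx n, hlift]
  exact sub_add_cancel _ _

theorem apply_coeff_eq_zero_of_extend_eq_zero (hθ : ∀ z, FormalSeries.coeff 0 (θ z) = π z)
    {x : MvPowerSeries (Fin ℓ) F} (hx : extend θ x = 0) {n : Fin ℓ →₀ ℕ}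
    (hlow : ∀ m < n, MvPowerSeries.coeff m x = 0) : π (MvPowerSeries.coeff n x) = 0 := by
  have h := coeff_extend_eq_add θ n x
  rwa [hx, FormalSeries.coeff_zero, hθ, Finset.sum_eq_zero, add_zero, eq_comm] at h
  intro p hp
  rw [hlow p.2 (snd_lt_of_mem_erase_antidiagonal hp), map_zero, FormalSeries.coeff_zero]

theorem degree_strictMono {σ : Type*} : StrictMono (Finsupp.degree : (σ →₀ ℕ) → ℕ) := by
  intro m n h
  obtain ⟨d, rfl⟩ := exists_add_of_le h.le
  have hd : d ≠ 0 := by rintro rfl; simp at h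
  rw [map_add]
  exact Nat.lt_add_of_pos_right (Nat.pos_of_ne_zero (mt (Finsupp.degree_eq_zero_iff d).mp hd))

theorem coeff_sum_monomial_mul {σ R : Type*} [Fintype σ] [DecidableEq σ] [Semiring R] {N : ℕ}
    (z : (σ →₀ ℕ) → MvPowerSeries σ R) {m : σ →₀ ℕ} (hm : m.degree ≤ N) :
    MvPowerSeries.coeff m (∑ n ∈ Finset.finsuppAntidiag Finset.univ N,
      MvPowerSeries.monomial n 1 * z n) =
        if m.degree = N then MvPowerSeries.coeff 0 (z m) else 0 := by
  have mem_iff (n : σ →₀ ℕ) : n ∈ Finset.finsuppAntidiag Finset.univ N ↔ n.degree = N := by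
    simp [Finset.mem_finsuppAntidiag, Finsupp.degree_eq_sum]
  have eq_of_le {n : σ →₀ ℕ} (hn : n.degree = N) (hnm : n ≤ m) : n = m :=
    hnm.eq_of_not_lt fun hlt => (degree_strictMono hlt).not_ge (hn ▸ hm)
  simp only [map_sum, MvPowerSeries.coeff_monomial_mul, one_mul]
  split_ifs with hdeg
  · rw [Finset.sum_eq_single m (fun n hn hne => if_neg fun hnm =>
        hne (eq_of_le ((mem_iff n).mp hn) hnm)) fun h => absurd ((mem_iff m).mpr hdeg) h,
      if_pos le_rfl, tsub_self]
  · refine Finset.sum_eq_zero fun n hn => if_neg fun hnm => hdeg ?_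
    rw [← eq_of_le ((mem_iff n).mp hn) hnm, (mem_iff n).mp hn]

/-- Successive approximation: an element of the kernel is corrected, degree by degree, by elements
of `J`. -/
theorem mem_of_extend_eq_zero (hθ : ∀ z, FormalSeries.coeff 0 (θ z) = π z)
    {J : TwoSidedIdeal (MvPowerSeries (Fin ℓ) F)} (hJ_closed : IsAdicallyClosed J)
    (hJ : ∀ z ∈ J, extend θ z = 0)
    (hlift : ∀ z, π z = 0 → ∃ y ∈ J, MvPowerSeries.coeff 0 y = z)
    {x : MvPowerSeries (Fin ℓ) F} (hx : extend θ x = 0) : x ∈ J := by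
  classical
  refine hJ_closed x fun N => ?_
  induction N with
  | zero => exact ⟨0, J.zero_mem, by simp⟩
  | succ N ih =>
    obtain ⟨y, hy, hxy⟩ := ih
    have hker (n : Fin ℓ →₀ ℕ) (hn : n.degree = N) : π (MvPowerSeries.coeff n (x - y)) = 0 := by
      refine apply_coeff_eq_zero_of_extend_eq_zero hθ (by rw [map_sub, hx, hJ y hy, sub_zero]) ?_
      intro m hm
      rw [map_sub, hxy m (hn ▸ degree_strictMono hm), sub_self]
    have hcorr (n : Fin ℓ →₀ ℕ) : ∃ z ∈ J,
        n.degree = N → MvPowerSeries.coeff 0 z = MvPowerSeries.coeff n (x - y) := by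
      by_cases hn : n.degree = N
      · obtain ⟨z, hz, h⟩ := hlift _ (hker n hn)
        exact ⟨z, hz, fun _ => h⟩
      · exact ⟨0, J.zero_mem, fun h => absurd h hn⟩
    choose z hz hz₀ using hcorr
    refine ⟨y + ∑ n ∈ Finset.finsuppAntidiag Finset.univ N, MvPowerSeries.monomial n 1 * z n,
      J.add_mem hy (sum_mem fun n _ => J.mul_mem_left _ _ (hz n)), fun m hm => ?_⟩
    rw [map_add, coeff_sum_monomial_mul z (Nat.lt_succ_iff.mp hm)]
    split_ifs with hmN
    · rw [hz₀ m hmN, map_sub, add_sub_cancel]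
    · rw [add_zero, hxy m (by omega)]

end Extend

/-! ### Flat quotients of algebras of formal power series -/

/-- The two-sided ideal of `F` consisting of the constant terms of the elements of `J`. -/
def constantTerms {σ F : Type*} [Ring F] (J : TwoSidedIdeal (MvPowerSeries σ F)) :
    TwoSidedIdeal F :=
  .mk' {z | ∃ y ∈ J, MvPowerSeries.constantCoeff y = z}
    ⟨0, J.zero_mem, map_zero _⟩
    (by rintro _ _ ⟨y, hy, rfl⟩ ⟨y', hy', rfl⟩; exact ⟨y + y', J.add_mem hy hy', map_add _ _ _⟩)
    (by rintro _ ⟨y, hy, rfl⟩; exact ⟨-y, J.neg_mem hy, map_neg _ _⟩)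
    (by
      rintro z _ ⟨y, hy, rfl⟩
      exact ⟨MvPowerSeries.C z * y, J.mul_mem_left _ _ hy, by simp⟩)
    (by
      rintro _ z ⟨y, hy, rfl⟩
      exact ⟨y * MvPowerSeries.C z, J.mul_mem_right _ _ hy, by simp⟩)

theorem mem_constantTerms {σ F : Type*} [Ring F] {J : TwoSidedIdeal (MvPowerSeries σ F)} {z : F} :
    z ∈ constantTerms J ↔ ∃ y ∈ J, MvPowerSeries.constantCoeff y = z :=
  TwoSidedIdeal.mem_mk' ..

section Quotient

universe u

variable {k : Type*} [Field k] {ℓ : ℕ}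

theorem exists_eq_sum_mul_X {R : Type*} [Semiring R] {x : MvPowerSeries (Fin ℓ) R}
    (hx : MvPowerSeries.constantCoeff x = 0) :
    ∃ y : Fin ℓ → MvPowerSeries (Fin ℓ) R, x = ∑ i, y i * MvPowerSeries.X i := by
  classical
  let y (i : Fin ℓ) : MvPowerSeries (Fin ℓ) R := fun m =>
    if (m + Finsupp.single i 1).support.min = ↑i then
      MvPowerSeries.coeff (m + Finsupp.single i 1) x else 0
  have coeff_y (i m) : MvPowerSeries.coeff m (y i) =
      if (m + Finsupp.single i 1).support.min = ↑i then
        MvPowerSeries.coeff (m + Finsupp.single i 1) x else 0 := rfl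
  have coeff_term (i n) : MvPowerSeries.coeff n (y i * MvPowerSeries.X i) =
      if n.support.min = ↑i then MvPowerSeries.coeff n x else 0 := by
    rw [MvPowerSeries.X_def, MvPowerSeries.coeff_mul_monomial, mul_one]
    split_ifs with hle hmin hmin
    · rw [coeff_y, tsub_add_cancel_of_le hle, if_pos hmin]
    · rw [coeff_y, tsub_add_cancel_of_le hle, if_neg hmin]
    · refine absurd (Finsupp.single_le_iff.mpr ?_) hle
      exact Nat.one_le_iff_ne_zero.mpr (Finsupp.mem_support_iff.mp (Finset.mem_of_min hmin))
    · rfl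
  refine ⟨y, MvPowerSeries.ext fun n => ?_⟩
  simp only [map_sum, coeff_term]
  rcases eq_or_ne n 0 with rfl | hn
  · simpa using hx
  · obtain ⟨i, hi⟩ := Finset.min_of_nonempty (Finsupp.support_nonempty_iff.mpr hn)
    simp [hi, WithTop.coe_inj]

variable {F : Type u} [Ring F] [Algebra k F]

theorem constantCoeff_algebraMap (f : FormalRing k ℓ) :
    MvPowerSeries.constantCoeff (algebraMap (FormalRing k ℓ) (MvPowerSeries (Fin ℓ) F) f) =
      algebraMap k F (MvPowerSeries.constantCoeff f) :=
  MvPowerSeries.constantCoeff_map _ _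

theorem mem_maximalIdeal_iff (f : FormalRing k ℓ) :
    f ∈ IsLocalRing.maximalIdeal (FormalRing k ℓ) ↔ MvPowerSeries.constantCoeff f = 0 := by
  rw [IsLocalRing.mem_maximalIdeal, mem_nonunits_iff, MvPowerSeries.isUnit_iff_constantCoeff,
    isUnit_iff_ne_zero, not_not]

theorem map_mem_maxIdeal {A : Type*} [Ring A] [Algebra (FormalRing k ℓ) A]
    (f : MvPowerSeries (Fin ℓ) F →ₐ[FormalRing k ℓ] A) {x : MvPowerSeries (Fin ℓ) F}
    (hx : MvPowerSeries.constantCoeff x = 0) : f x ∈ maxIdeal k ℓ A := by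
  obtain ⟨y, rfl⟩ := exists_eq_sum_mul_X hx
  have algebraMap_X (i : Fin ℓ) :
      algebraMap (FormalRing k ℓ) (MvPowerSeries (Fin ℓ) F) (MvPowerSeries.X i) =
        MvPowerSeries.X i := MvPowerSeries.map_X _ i
  simp only [map_sum, map_mul, ← algebraMap_X, f.commutes]
  exact Ideal.sum_mem _ fun i _ => Ideal.mul_mem_left _ _ <| Ideal.mem_map_of_mem _ <|
    (mem_maximalIdeal_iff _).mpr (MvPowerSeries.constantCoeff_X i)

variable {A : Type u} [Ring A] [Algebra k A] {π : F →ₐ[k] A}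
  {J : TwoSidedIdeal (MvPowerSeries (Fin ℓ) F)}

theorem ker_eq_maxIdeal {Φ : MvPowerSeries (Fin ℓ) F ⧸ J.asIdeal →+* A}
    (hΦ : ∀ x, Φ (Ideal.Quotient.mk _ x) = π (MvPowerSeries.constantCoeff x))
    (hlift : ∀ z, π z = 0 → ∃ y ∈ J, MvPowerSeries.constantCoeff y = z) :
    RingHom.ker Φ = maxIdeal k ℓ (MvPowerSeries (Fin ℓ) F ⧸ J.asIdeal) := by
  refine le_antisymm (fun a ha => ?_) (Ideal.map_le_iff_le_comap.mpr fun f hf => ?_)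
  · obtain ⟨x, rfl⟩ := Ideal.Quotient.mk_surjective a
    obtain ⟨y, hy, hyx⟩ := hlift _ ((hΦ x).symm.trans ha)
    have hmk : Ideal.Quotient.mk J.asIdeal x = Ideal.Quotient.mkₐ (FormalRing k ℓ) _ (x - y) := by
      rw [Ideal.Quotient.mkₐ_eq_mk, Ideal.Quotient.eq, sub_sub_cancel]
      exact hy
    rw [hmk]
    exact map_mem_maxIdeal _ (by rw [map_sub, hyx, sub_self])
  · refine (hΦ _).trans ?_
    rw [constantCoeff_algebraMap, (mem_maximalIdeal_iff f).mp hf, map_zero, map_zero]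

variable {θ : F →ₗ[k] FormalSeries ℓ A}

theorem isTopologicallyFree_quotient (hπ : Function.Surjective π)
    (hθ : ∀ z, FormalSeries.coeff 0 (θ z) = π z) (hJ_closed : IsAdicallyClosed J)
    (hJ : ∀ z ∈ J, extend θ z = 0)
    (hlift : ∀ z, π z = 0 → ∃ y ∈ J, MvPowerSeries.constantCoeff y = z) :
    IsTopologicallyFree k ℓ (MvPowerSeries (Fin ℓ) F ⧸ J.asIdeal) := by
  have hker : J.asIdeal.restrictScalars (FormalRing k ℓ) = LinearMap.ker (extend θ) :=
    le_antisymm (fun x hx => hJ x hx) fun x hx =>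
      mem_of_extend_eq_zero (π := π.toLinearMap) hθ hJ_closed hJ hlift hx
  exact ⟨A, inferInstance, inferInstance,
    ⟨(Submodule.Quotient.restrictScalarsEquiv (FormalRing k ℓ) J.asIdeal).symm ≪≫ₗ
      Submodule.quotEquivOfEq _ _ hker ≪≫ₗ (extend θ).quotKerEquivOfSurjective
        (extend_surjective (π := π.toLinearMap) hθ hπ)⟩⟩

theorem exists_flatFormalDeformation (hπ : Function.Surjective π)
    (hθ : ∀ z, FormalSeries.coeff 0 (θ z) = π z) (hJ_closed : IsAdicallyClosed J)
    (hJ : ∀ z ∈ J, extend θ z = 0)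
    (hlift : ∀ z, π z = 0 → ∃ y ∈ J, MvPowerSeries.constantCoeff y = z) :
    ∃ D : FlatFormalDeformation k ℓ A (MvPowerSeries (Fin ℓ) F ⧸ J.asIdeal),
      ∀ x, D.φ (Ideal.Quotient.mk _ (Ideal.Quotient.mk _ x)) =
        π (MvPowerSeries.constantCoeff x) := by
  have hconst (z) (hz : z ∈ J) : π (MvPowerSeries.constantCoeff z) = 0 :=
    apply_coeff_eq_zero_of_extend_eq_zero (π := π.toLinearMap) hθ (hJ z hz) (n := 0) (by simp)
  let Φ : MvPowerSeries (Fin ℓ) F ⧸ J.asIdeal →+* A :=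
    Ideal.Quotient.lift _ ((π : F →+* A).comp MvPowerSeries.constantCoeff) hconst
  have hΦ_surj : Function.Surjective Φ := fun a => by
    obtain ⟨z, rfl⟩ := hπ a
    exact ⟨Ideal.Quotient.mk _ (MvPowerSeries.C z),
      congrArg π (MvPowerSeries.constantCoeff_C z)⟩
  let φ := (Ideal.quotEquivOfEq (ker_eq_maxIdeal (Φ := Φ) (fun _ => rfl) hlift).symm).trans
    (RingHom.quotientKerEquivOfSurjective hΦ_surj)
  refine ⟨⟨isTopologicallyFree_quotient hπ hθ hJ_closed hJ hlift, φ, fun z => ?_⟩, fun _ => rfl⟩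
  change π (MvPowerSeries.constantCoeff
    (algebraMap (FormalRing k ℓ) (MvPowerSeries (Fin ℓ) F) (MvPowerSeries.C z))) = _
  rw [constantCoeff_algebraMap, MvPowerSeries.constantCoeff_C, AlgHom.commutes]

end Quotient

end FormalDeformation

namespace SymplecticReflection

open FormalDeformation

/-! ### Words and descents -/

section Descents

variable {ι : Type*} [LinearOrder ι]

/-- The number of inversions of a word, that is, of pairs of letters in decreasing order. -/
def inversions : List ι → ℕ
  | [] => 0
  | i :: w => w.countP (· < i) + inversions w

theorem inversions_swap_lt (a b : List ι) {x y : ι} (hxy : y < x) :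
    inversions (a ++ y :: x :: b) < inversions (a ++ x :: y :: b) := by
  induction a with
  | nil =>
    have hx : (x :: b).countP (· < y) = b.countP (· < y) :=
      List.countP_cons_of_neg (by simpa using hxy.le)
    have hy : (y :: b).countP (· < x) = b.countP (· < x) + 1 :=
      List.countP_cons_of_pos (by simpa using hxy)
    simp only [inversions, List.nil_append, hx, hy]
    omega
  | cons i a ih =>
    have hperm : (a ++ y :: x :: b).Perm (a ++ x :: y :: b) := (List.Perm.swap x y b).append_left a
    simp only [List.cons_append, inversions, hperm.countP_eq]
    omega

/-- The word `w` is `a x y b`, where the letters `x` and `y` are in decreasing order. -/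
def IsDescent (w a : List ι) (x y : ι) (b : List ι) : Prop :=
  w = a ++ x :: y :: b ∧ y < x

theorem exists_isDescent {w : List ι} (hw : ¬ w.SortedLE) : ∃ a x y b, IsDescent w a x y b := by
  rw [List.sortedLE_iff_isChain, List.isChain_iff_forall_rel_of_append_cons_cons] at hw
  push Not at hw
  obtain ⟨x, y, a, b, hw, hxy⟩ := hw
  exact ⟨a, x, y, b, hw, hxy⟩

theorem IsDescent.not_sortedLE {w a b : List ι} {x y : ι} (h : IsDescent w a x y b) :
    ¬ w.SortedLE := by
  rw [List.sortedLE_iff_isChain, List.isChain_iff_forall_rel_of_append_cons_cons]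
  exact fun hw => (hw h.1).not_gt h.2

/-- The combinatorial part of the diamond lemma. -/
theorem IsDescent.eq_of_overlap_of_disjoint {A : Type*} {w : List ι}
    {E : List ι → ι → ι → List ι → A}
    (overlap : ∀ a x y z b, w = a ++ x :: y :: z :: b → y < x → z < y →
      E a x y (z :: b) = E (a ++ [x]) y z b)
    (disjoint : ∀ a x y m x' y' b, w = a ++ x :: y :: (m ++ x' :: y' :: b) → y < x → y' < x' →
      E a x y (m ++ x' :: y' :: b) = E (a ++ x :: y :: m) x' y' b)
    {a b a' b' : List ι} {x y x' y' : ι} (h : IsDescent w a x y b)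
    (h' : IsDescent w a' x' y' b') : E a x y b = E a' x' y' b' := by
  wlog hlen : a.length ≤ a'.length generalizing a b a' b' x y x' y'
  · exact (this h' h (le_of_not_ge hlen)).symm
  obtain ⟨rfl, hxy⟩ := h
  obtain ⟨heq, hxy'⟩ := h'
  obtain ⟨c, rfl⟩ : a <+: a' := List.prefix_of_prefix_length_le ⟨_, heq⟩ ⟨_, rfl⟩ hlen
  simp only [List.append_assoc, List.append_cancel_left_eq] at heq
  match c with
  | [] =>
    simp only [List.nil_append, List.cons.injEq] at heq
    obtain ⟨rfl, rfl, rfl⟩ := heq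
    rw [List.append_nil]
  | [_] =>
    simp only [List.singleton_append, List.cons.injEq] at heq
    obtain ⟨rfl, rfl, rfl⟩ := heq
    exact overlap a x y y' b' rfl hxy hxy'
  | _ :: _ :: m =>
    simp only [List.cons_append, List.cons.injEq] at heq
    obtain ⟨rfl, rfl, rfl⟩ := heq
    exact disjoint a x y m x' y' b' rfl hxy hxy'

/-- Words are compared first by length and then by the number of inversions. -/
def WordLT : List ι → List ι → Prop :=
  InvImage (Prod.Lex (· < ·) (· < ·)) fun w => (w.length, inversions w)

theorem wordLT_wellFounded : WellFounded (WordLT (ι := ι)) :=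
  InvImage.wf _ (WellFounded.prod_lex wellFounded_lt wellFounded_lt)

theorem WordLT.trans {u v w : List ι} (huv : WordLT u v) (hvw : WordLT v w) : WordLT u w :=
  _root_.trans (r := Prod.Lex (· < ·) (· < ·)) huv hvw

theorem wordLT_of_length_lt {w w' : List ι} (h : w.length < w'.length) : WordLT w w' :=
  Prod.Lex.left _ _ h

theorem wordLT_swap (a b : List ι) {x y : ι} (hxy : y < x) :
    WordLT (a ++ y :: x :: b) (a ++ x :: y :: b) :=
  Prod.lex_iff.mpr (.inr ⟨by simp, inversions_swap_lt a b hxy⟩)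

end Descents

/-! ### The algebra `G ⋉ T(V)` -/

section SmashTensor

open TensorAlgebra

variable {G V ι : Type*} [Group G] [AddCommGroup V] [Module ℂ V]
  [DistribMulAction G V] [SMulCommClass G ℂ V]

variable (G) in
/-- The inclusion of `V` into `G ⋉ T(V)`. -/
def smashι : V →ₗ[ℂ] SmashTensor G V :=
  SkewMonoidAlgebra.lsingle ℂ (1 : G) ∘ₗ TensorAlgebra.ι ℂ

variable (V) in
/-- The inclusion of `G` into `G ⋉ T(V)`. -/
abbrev smashOf : G →* SmashTensor G V :=
  SkewMonoidAlgebra.of (TensorAlgebra ℂ V) G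

theorem smashι_apply (x : V) : smashι G x = SkewMonoidAlgebra.single 1 (TensorAlgebra.ι ℂ x) := rfl

theorem smashOf_mul_smashι (g : G) (x : V) :
    smashOf V g * smashι G x = smashι G (g • x) * smashOf V g := by
  simp [smashι_apply, SkewMonoidAlgebra.of_apply, SkewMonoidAlgebra.single_mul_single,
    smul_tensor_def, tensorMap]

theorem smashOf_conj_mul (g s : G) :
    smashOf V (g * s * g⁻¹) * smashOf V g = smashOf V g * smashOf V s := by
  rw [← map_mul, ← map_mul, inv_mul_cancel_right]

variable (G) in
/-- The product in `G ⋉ T(V)` of the basis vectors indexed by a word. -/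
def word (e : Module.Basis ι ℂ V) (w : List ι) : SmashTensor G V :=
  (w.map fun i => smashι G (e i)).prod

variable (e : Module.Basis ι ℂ V)

@[simp]
theorem word_nil : word G e [] = 1 := rfl

@[simp]
theorem word_cons (i : ι) (w : List ι) : word G e (i :: w) = smashι G (e i) * word G e w := by
  simp [word]

@[simp]
theorem word_append (w w' : List ι) : word G e (w ++ w') = word G e w * word G e w' := by
  simp [word]

theorem word_append_cons_cons_mul (a b : List ι) (i j : ι) (q : SmashTensor G V) :
    word G e (a ++ i :: j :: b) * q =
      word G e a * smashι G (e i) * smashι G (e j) * (word G e b * q) := by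
  simp only [word_append, word_cons, mul_assoc]

theorem word_eq_single (w : List ι) :
    word G e w = SkewMonoidAlgebra.single 1 (e.tensorAlgebra (FreeMonoid.ofList w)) := by
  have htensor : e.tensorAlgebra (FreeMonoid.ofList w) =
      (w.map fun i => TensorAlgebra.ι ℂ (e i)).prod := by
    simp [Module.Basis.tensorAlgebra, FreeAlgebra.basisFreeMonoid,
      FreeAlgebra.equivMonoidAlgebraFreeMonoid, FreeMonoid.lift_apply, map_list_prod,
      Function.comp_def]
  rw [htensor]
  exact (map_list_prod SkewMonoidAlgebra.singleOneRingHom _).trans (by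
    rw [List.map_map]; rfl) |>.symm

/-- The basis of `G ⋉ T(V)` formed by the products `w g` of a word in a basis of `V` and an
element of `G`. -/
def smashBasis : Module.Basis (Σ _ : G, FreeMonoid ι) ℂ (SmashTensor G V) :=
  (Finsupp.basis fun _ : G => e.tensorAlgebra).map
    (SkewMonoidAlgebra.coeffLinearEquiv (S := ℂ)).symm

theorem smashBasis_apply (g : G) (w : List ι) :
    smashBasis e ⟨g, FreeMonoid.ofList w⟩ = word G e w * smashOf V g := by
  rw [word_eq_single, SkewMonoidAlgebra.of_apply, SkewMonoidAlgebra.single_mul_single, one_mul,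
    smul_one, mul_one, smashBasis, Module.Basis.map_apply, Finsupp.coe_basis]
  rfl

section Extend

variable {N : Type*} [AddCommGroup N] [Module ℂ N]

theorem linearMap_ext_word {f f' : SmashTensor G V →ₗ[ℂ] N}
    (h : ∀ w g, f (word G e w * smashOf V g) = f' (word G e w * smashOf V g)) : f = f' :=
  (smashBasis e).ext fun ⟨g, w⟩ => by
    have hb := smashBasis_apply e g (FreeMonoid.toList w)
    rw [FreeMonoid.ofList_toList] at hb
    rw [hb]
    exact h _ g

/-- The linear map on `G ⋉ T(V)` with prescribed values on the products `w g` of a word and an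
element of `G`. -/
def ofWordValues (v : List ι → G → N) : SmashTensor G V →ₗ[ℂ] N :=
  (smashBasis e).constr ℂ fun i => v (FreeMonoid.toList i.2) i.1

@[simp]
theorem ofWordValues_word_mul (v : List ι → G → N) (w : List ι) (g : G) :
    ofWordValues e v (word G e w * smashOf V g) = v w g := by
  rw [← smashBasis_apply, ofWordValues, Module.Basis.constr_basis]
  rfl

end Extend

section Grading

open Submodule Pointwise

variable (G V) in
/-- The copy of `V` in `G ⋉ T(V)`. -/
abbrev vectors : Submodule ℂ (SmashTensor G V) := LinearMap.range (smashι G)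

variable (G V) in
/-- The copy of the group algebra `ℂ[G]` in `G ⋉ T(V)`. -/
abbrev groupSpan : Submodule ℂ (SmashTensor G V) := span ℂ (Set.range (smashOf V))

variable (G V) in
/-- The elements of degree `n` in `G ⋉ T(V)`, for the grading in which `V` has degree `1` and `G`
has degree `0`. -/
def gradedPiece (n : ℕ) : Submodule ℂ (SmashTensor G V) :=
  vectors G V ^ n * groupSpan G V

theorem commute_groupSpan_vectors : Commute (groupSpan G V) (vectors G V) := by
  rw [commute_iff_eq, ← span_eq (vectors G V), span_mul_span, span_mul_span]
  congr 1
  ext z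
  simp only [Set.mem_mul, Set.mem_range, SetLike.mem_coe, LinearMap.mem_range,
    exists_exists_eq_and]
  constructor
  · rintro ⟨g, x, rfl⟩
    exact ⟨g • x, g, (smashOf_mul_smashι g x).symm⟩
  · rintro ⟨x, g, rfl⟩
    exact ⟨g, g⁻¹ • x, by rw [smashOf_mul_smashι, smul_inv_smul]⟩

theorem groupSpan_mul_groupSpan_le : groupSpan G V * groupSpan G V ≤ groupSpan G V := by
  rw [span_mul_span, ← MonoidHom.coe_mrange, coe_mul_coe]
  exact le_rfl

theorem mul_mem_gradedPiece {a b : ℕ} {p q : SmashTensor G V} (hp : p ∈ gradedPiece G V a)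
    (hq : q ∈ gradedPiece G V b) : p * q ∈ gradedPiece G V (a + b) := by
  have hle : gradedPiece G V a * gradedPiece G V b ≤ gradedPiece G V (a + b) :=
    calc gradedPiece G V a * gradedPiece G V b
      _ = vectors G V ^ a * (groupSpan G V * vectors G V ^ b) * groupSpan G V := by
          simp only [gradedPiece, mul_assoc]
      _ = vectors G V ^ (a + b) * (groupSpan G V * groupSpan G V) := by
          rw [(commute_groupSpan_vectors.pow_right b).eq, pow_add]
          simp only [mul_assoc]
      _ ≤ gradedPiece G V (a + b) := mul_le_mul_right groupSpan_mul_groupSpan_le _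
  exact hle (mul_mem_mul hp hq)

theorem smashOf_mem_gradedPiece (g : G) : smashOf V g ∈ gradedPiece G V 0 := by
  rw [gradedPiece, pow_zero, one_mul]
  exact subset_span ⟨g, rfl⟩

theorem smashι_mem_gradedPiece (x : V) : smashι G x ∈ gradedPiece G V 1 := by
  rw [gradedPiece, pow_one, ← mul_one (smashι G x)]
  exact mul_mem_mul ⟨x, rfl⟩ (subset_span ⟨1, map_one _⟩)

theorem word_mem_gradedPiece (w : List ι) : word G e w ∈ gradedPiece G V w.length := by
  induction w with
  | nil => simpa using smashOf_mem_gradedPiece (V := V) (1 : G)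
  | cons i w ih =>
    rw [word_cons, List.length_cons, add_comm]
    exact mul_mem_gradedPiece (smashι_mem_gradedPiece _) ih

theorem gradedPiece_eq_span (n : ℕ) :
    gradedPiece G V n = span ℂ {z | ∃ w g, w.length = n ∧ word G e w * smashOf V g = z} := by
  have hspan : vectors G V = span ℂ (Set.range fun i => smashι G (e i)) := by
    rw [vectors, LinearMap.range_eq_map, ← e.span_eq, map_span, ← Set.range_comp]
    rfl
  rw [gradedPiece, hspan, span_pow, span_mul_span]
  congr 1
  ext z
  simp only [Set.mem_mul, Set.mem_pow, Set.mem_range, Set.mem_ofPred_eq]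
  constructor
  · rintro ⟨_, ⟨f, rfl⟩, _, ⟨g, rfl⟩, rfl⟩
    choose i hi using fun j => (f j).2
    refine ⟨List.ofFn i, g, List.length_ofFn, ?_⟩
    simp [word, List.map_ofFn, Function.comp_def, hi]
  · rintro ⟨w, g, rfl, rfl⟩
    refine ⟨_, ⟨fun j => ⟨_, w.get j, rfl⟩, ?_⟩, _, ⟨g, rfl⟩, rfl⟩
    simp [word, ← List.map_ofFn, ← Function.comp_def]

end Grading

end SmashTensor

/-! ### The Poincaré–Birkhoff–Witt theorem for Drinfeld brackets -/

section Bracket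

variable {G V K N ι : Type*} [Group G] [Fintype G] [AddCommGroup V] [Module ℂ V]
  [DistribMulAction G V] [SMulCommClass G ℂ V] [CommRing K] [Algebra ℂ K]
  [AddCommGroup N] [Module ℂ N] [Module K N]
  (κ : G → V →ₗ[ℂ] V →ₗ[ℂ] K) (f : SmashTensor G V →ₗ[ℂ] N)

/-- The value `∑_s κ_s(x, y) f(p s q)` of `f` at `p κ(x, y) q`, where `κ(x, y) = ∑_s κ_s(x, y) s`
takes values in the group algebra `K[G]`. -/
def correction (p : SmashTensor G V) (x y : V) (q : SmashTensor G V) : N :=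
  ∑ s, κ s x y • f (p * smashOf V s * q)

/-- The value that the relation `x y = y x + κ(x, y)` prescribes for `f` at `p x y q`. -/
def exchange (p : SmashTensor G V) (x y : V) (q : SmashTensor G V) : N :=
  f (p * smashι G y * smashι G x * q) + correction κ f p x y q

/-- The failure of `f` to be compatible with the relation `x y = y x + κ(x, y)` multiplied by `p`
on the left and by `q` on the right. -/
def defect (p : SmashTensor G V) (x y : V) (q : SmashTensor G V) : N :=
  f (p * smashι G x * smashι G y * q) - exchange κ f p x y q

/-- A linear map on `G ⋉ T(V)` respects the bracket `κ` if it extends `K`-linearly to a map that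
vanishes on the two-sided ideal generated by the elements `x y - y x - κ(x, y)`. -/
def RespectsBracket : Prop :=
  ∀ p x y q, defect κ f p x y q = 0

/-- Drinfeld's conditions on a bracket `κ(x, y) = ∑_s κ_s(x, y) s`, necessary and sufficient for
the Poincaré–Birkhoff–Witt property of the relations `x y - y x = κ(x, y)`. The Jacobi identity
is the vanishing of `[κ(x, y), z] + [κ(y, z), x] + [κ(z, x), y]`, in which the coefficient of `s`
is a vector because `s z - z s = (s • z - z) s`. -/
structure IsDrinfeld : Prop where
  alt : ∀ s, (κ s).IsAlt
  conj : ∀ g s x y, κ (g * s * g⁻¹) (g • x) (g • y) = κ s x y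
  jacobi : ∀ s x y z, κ s x y ⊗ₜ[ℂ] (s • z - z) + κ s y z ⊗ₜ[ℂ] (s • x - x) +
    κ s z x ⊗ₜ[ℂ] (s • y - y) = 0

variable {κ}

theorem defect_self (hκ : IsDrinfeld κ) (p : SmashTensor G V) (x : V) (q : SmashTensor G V) :
    defect κ f p x x q = 0 := by
  simp [defect, exchange, correction, (hκ.alt _).self_eq_zero]

theorem correction_swap (hκ : IsDrinfeld κ) (p : SmashTensor G V) (x y : V)
    (q : SmashTensor G V) : correction κ f p y x q = -correction κ f p x y q := by
  simp only [correction, ← (hκ.alt _).neg x y, neg_smul, Finset.sum_neg_distrib]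

theorem defect_swap (hκ : IsDrinfeld κ) (p : SmashTensor G V) (x y : V)
    (q : SmashTensor G V) : defect κ f p y x q = -defect κ f p x y q := by
  simp only [defect, exchange, correction_swap f hκ p x y]
  abel

theorem defect_mul_smashOf (hκ : IsDrinfeld κ) (p : SmashTensor G V) (g : G) (x y : V)
    (q : SmashTensor G V) :
    defect κ f (p * smashOf V g) x y q = defect κ f p (g • x) (g • y) (smashOf V g * q) := by
  have hmove (u v : V) : p * smashOf V g * smashι G u * smashι G v * q =
      p * smashι G (g • u) * smashι G (g • v) * (smashOf V g * q) := by
    rw [mul_assoc p, smashOf_mul_smashι, ← mul_assoc p, mul_assoc _ (smashOf V g),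
      smashOf_mul_smashι, ← mul_assoc, mul_assoc _ (smashOf V g)]
  have hcorrection : correction κ f (p * smashOf V g) x y q =
      correction κ f p (g • x) (g • y) (smashOf V g * q) := by
    refine Fintype.sum_equiv (MulAut.conj g).toEquiv _ _ fun s => ?_
    change _ = κ (g * s * g⁻¹) (g • x) (g • y) • f (p * smashOf V (g * s * g⁻¹) * (smashOf V g * q))
    rw [hκ.conj, ← mul_assoc _ _ q, mul_assoc p _ (smashOf V g), smashOf_conj_mul, ← mul_assoc p]
  simp only [defect, exchange, hmove, hcorrection]

theorem correction_mul_sub_mul_correction (p : SmashTensor G V) (x y z : V)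
    (q : SmashTensor G V) :
    correction κ f p x y (smashι G z * q) - correction κ f (p * smashι G z) x y q =
      ∑ s, κ s x y • f (p * smashι G (s • z - z) * smashOf V s * q) := by
  rw [correction, correction, ← Finset.sum_sub_distrib]
  refine Finset.sum_congr rfl fun s _ => ?_
  rw [← smul_sub, ← map_sub, ← mul_assoc, mul_assoc p, smashOf_mul_smashι, ← mul_assoc p, ← sub_mul,
    ← sub_mul, ← mul_sub, ← map_sub]

theorem sum_jacobi [IsScalarTower ℂ K N] (hκ : IsDrinfeld κ) (p : SmashTensor G V) (x y z : V)
    (q : SmashTensor G V) :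
    (∑ s, κ s x y • f (p * smashι G (s • z - z) * smashOf V s * q)) +
      (∑ s, κ s y z • f (p * smashι G (s • x - x) * smashOf V s * q)) +
      ∑ s, κ s z x • f (p * smashι G (s • y - y) * smashOf V s * q) = 0 := by
  rw [← Finset.sum_add_distrib, ← Finset.sum_add_distrib]
  refine Finset.sum_eq_zero fun s _ => ?_
  let insertVector : V →ₗ[ℂ] N :=
    f ∘ₗ LinearMap.mulRight ℂ (smashOf V s * q) ∘ₗ LinearMap.mulLeft ℂ p ∘ₗ smashι G
  let act : K →ₗ[ℂ] N →ₗ[ℂ] N := (LinearMap.lsmul K N).restrictScalars₁₂ ℂ ℂ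
  have h := congr_arg (TensorProduct.lift (act.compl₂ insertVector)) (hκ.jacobi s x y z)
  simpa [act, insertVector, mul_assoc] using h

theorem correction_sub_correction {p m q : SmashTensor G V} {x y x' y' : V}
    (hleft : ∀ s, defect κ f (p * smashOf V s * m) x' y' q = 0)
    (hright : ∀ s, defect κ f p x y (m * smashOf V s * q) = 0) :
    correction κ f p x y (m * smashι G x' * smashι G y' * q) -
      correction κ f p x y (m * smashι G y' * smashι G x' * q) =
    correction κ f (p * smashι G x * smashι G y * m) x' y' q -
      correction κ f (p * smashι G y * smashι G x * m) x' y' q := by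
  have hl (s : G) : f (p * smashOf V s * (m * smashι G x' * smashι G y' * q)) -
      f (p * smashOf V s * (m * smashι G y' * smashι G x' * q)) =
      ∑ s', κ s' x' y' • f (p * smashOf V s * m * smashOf V s' * q) := by
    have h := hleft s
    simp only [defect, exchange, correction, ← mul_assoc] at h ⊢
    rw [← sub_sub, sub_eq_zero] at h
    exact h
  have hr (s' : G) : f (p * smashι G x * smashι G y * m * smashOf V s' * q) -
      f (p * smashι G y * smashι G x * m * smashOf V s' * q) =
      ∑ s, κ s x y • f (p * smashOf V s * m * smashOf V s' * q) := by
    have h := hright s'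
    simp only [defect, exchange, correction, ← mul_assoc] at h ⊢
    rw [← sub_sub, sub_eq_zero] at h
    exact h
  simp only [correction, ← Finset.sum_sub_distrib, ← smul_sub, hl, hr, Finset.smul_sum]
  rw [Finset.sum_comm]
  simp only [smul_comm (κ _ x y)]

theorem exchange_eq_exchange_of_overlap [IsScalarTower ℂ K N] (hκ : IsDrinfeld κ)
    {p q : SmashTensor G V} {x y z : V}
    (hyxz : defect κ f (p * smashι G y) x z q = 0)
    (hyzx : defect κ f p y z (smashι G x * q) = 0)
    (hxzy : defect κ f p x z (smashι G y * q) = 0)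
    (hzxy : defect κ f (p * smashι G z) x y q = 0) :
    exchange κ f p x y (smashι G z * q) = exchange κ f (p * smashι G x) y z q := by
  have hjacobi := sum_jacobi f hκ p x y z q
  simp only [← correction_mul_sub_mul_correction, correction_swap f hκ _ x z] at hjacobi
  simp only [defect, exchange, ← mul_assoc] at hyxz hyzx hxzy hzxy ⊢
  linear_combination (norm := abel) hyxz + hyzx - hxzy - hzxy + hjacobi

theorem exchange_eq_exchange_of_disjoint {p m q : SmashTensor G V} {x y x' y' : V}
    (hleft : ∀ s, defect κ f (p * smashOf V s * m) x' y' q = 0)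
    (hright : ∀ s, defect κ f p x y (m * smashOf V s * q) = 0)
    (hyx : defect κ f (p * smashι G y * smashι G x * m) x' y' q = 0)
    (hy'x' : defect κ f p x y (m * smashι G y' * smashι G x' * q) = 0) :
    exchange κ f p x y (m * smashι G x' * smashι G y' * q) =
      exchange κ f (p * smashι G x * smashι G y * m) x' y' q := by
  have hcorrection := correction_sub_correction f hleft hright
  simp only [defect, exchange, ← mul_assoc] at hyx hy'x' hcorrection ⊢
  linear_combination (norm := abel) hyx - hy'x' + hcorrection

section Multilinear

variable [IsScalarTower ℂ K N]

variable (κ) in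
/-- The defect as a bilinear function of the two outer arguments. -/
def defectOuter (x y : V) : SmashTensor G V →ₗ[ℂ] SmashTensor G V →ₗ[ℂ] N :=
  LinearMap.mk₂ ℂ (fun p q => defect κ f p x y q)
    (fun p p' q => by
      simp only [defect, exchange, correction, add_mul, map_add, smul_add, Finset.sum_add_distrib]
      abel)
    (fun c p q => by
      simp only [defect, exchange, correction, smul_mul_assoc, map_smul, smul_comm _ c,
        ← Finset.smul_sum, smul_add, smul_sub])
    (fun p q q' => by
      simp only [defect, exchange, correction, mul_add, map_add, smul_add, Finset.sum_add_distrib]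
      abel)
    (fun c p q => by
      simp only [defect, exchange, correction, mul_smul_comm, map_smul, smul_comm _ c,
        ← Finset.smul_sum, smul_add, smul_sub])

variable (κ) in
/-- The defect as a bilinear function of the two inner arguments. -/
def defectInner (p q : SmashTensor G V) : V →ₗ[ℂ] V →ₗ[ℂ] N :=
  LinearMap.mk₂ ℂ (fun x y => defect κ f p x y q)
    (fun x x' y => by
      simp only [defect, exchange, correction, map_add, LinearMap.add_apply, mul_add, add_mul,
        add_smul, Finset.sum_add_distrib]
      abel)
    (fun c x y => by
      simp only [defect, exchange, correction, map_smul, LinearMap.smul_apply, mul_smul_comm,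
        smul_mul_assoc, smul_assoc, ← Finset.smul_sum, smul_add, smul_sub])
    (fun x y y' => by
      simp only [defect, exchange, correction, map_add, mul_add, add_mul, add_smul,
        Finset.sum_add_distrib]
      abel)
    (fun c x y => by
      simp only [defect, exchange, correction, map_smul, mul_smul_comm,
        smul_mul_assoc, smul_assoc, ← Finset.smul_sum, smul_add, smul_sub])

end Multilinear

section Words

variable [LinearOrder ι] (e : Module.Basis ι ℂ V)

variable (κ) in
/-- The map `f` is compatible with the relations that exchange two adjacent letters of `w` in
decreasing order. -/
def RespectsDescents (w : List ι) : Prop :=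
  ∀ ⦃a x y b⦄, IsDescent w a x y b →
    ∀ g, defect κ f (word G e a) (e x) (e y) (word G e b * smashOf V g) = 0

variable {f e}

theorem exchange_congr {f f' : SmashTensor G V →ₗ[ℂ] N} {a b : List ι} {x y : ι} (hxy : y < x)
    (h : ∀ w, WordLT w (a ++ x :: y :: b) → ∀ g,
      f (word G e w * smashOf V g) = f' (word G e w * smashOf V g)) (g : G) :
    exchange κ f (word G e a) (e x) (e y) (word G e b * smashOf V g) =
      exchange κ f' (word G e a) (e x) (e y) (word G e b * smashOf V g) := by
  have hlow {p : SmashTensor G V} (hp : p ∈ gradedPiece G V (a.length + 0 + (b.length + 0))) :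
      f p = f' p := by
    suffices hle : gradedPiece G V _ ≤ LinearMap.eqLocus f f' from hle hp
    rw [gradedPiece_eq_span e, Submodule.span_le]
    rintro _ ⟨w, g, hw, rfl⟩
    refine h w (wordLT_of_length_lt ?_) g
    simp only [hw, List.length_append, List.length_cons]
    omega
  have hswap := h _ (wordLT_swap a b hxy) g
  rw [word_append_cons_cons_mul] at hswap
  simp only [exchange, correction, hswap]
  congr 1
  refine Finset.sum_congr rfl fun s _ => ?_
  rw [hlow (mul_mem_gradedPiece (mul_mem_gradedPiece (word_mem_gradedPiece e a)
    (smashOf_mem_gradedPiece s)) (mul_mem_gradedPiece (word_mem_gradedPiece e b)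
    (smashOf_mem_gradedPiece g)))]

theorem RespectsBracket.ext {f f' : SmashTensor G V →ₗ[ℂ] N} (hf : RespectsBracket κ f)
    (hf' : RespectsBracket κ f') (h : ∀ w : List ι, w.SortedLE → ∀ g,
      f (word G e w * smashOf V g) = f' (word G e w * smashOf V g)) : f = f' := by
  refine linearMap_ext_word e fun w => wordLT_wellFounded.induction
    (C := fun w => ∀ g, f (word G e w * smashOf V g) = f' (word G e w * smashOf V g))
    w fun w ih g => ?_
  by_cases hw : w.SortedLE
  · exact h w hw g
  · obtain ⟨a, x, y, b, rfl, hxy⟩ := exists_isDescent hw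
    rw [word_append_cons_cons_mul, sub_eq_zero.mp (hf _ _ _ _), sub_eq_zero.mp (hf' _ _ _ _)]
    exact exchange_congr hxy ih g

variable [IsScalarTower ℂ K N]

theorem defect_word_eq_zero (hκ : IsDrinfeld κ) {a b : List ι}
    (h : ∀ w : List ι, w.length = a.length + b.length + 2 → RespectsDescents κ f e w)
    (x y : V) (g : G) : defect κ f (word G e a) x y (word G e b * smashOf V g) = 0 := by
  suffices hinner : defectInner κ f (word G e a) (word G e b * smashOf V g) = 0 from
    LinearMap.congr_fun₂ hinner x y
  have hdescent {i j : ι} (hij : j < i) :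
      defect κ f (word G e a) (e i) (e j) (word G e b * smashOf V g) = 0 :=
    h (a ++ i :: j :: b) (by simp only [List.length_append, List.length_cons]; omega) ⟨rfl, hij⟩ g
  refine LinearMap.ext_basis e e fun i j => ?_
  change defect κ f _ (e i) (e j) _ = 0
  rcases lt_trichotomy i j with hij | rfl | hij
  · rw [defect_swap f hκ, hdescent hij, neg_zero]
  · exact defect_self f hκ _ _ _
  · exact hdescent hij

theorem defect_eq_zero_of_mem_gradedPiece (hκ : IsDrinfeld κ) {m n : ℕ}
    (h : ∀ w : List ι, w.length = m + n + 2 → RespectsDescents κ f e w)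
    {p q : SmashTensor G V} (hp : p ∈ gradedPiece G V m) (hq : q ∈ gradedPiece G V n) (x y : V) :
    defect κ f p x y q = 0 := by
  have hword {a : List ι} (ha : a.length = m) (x y : V) {q : SmashTensor G V}
      (hq : q ∈ gradedPiece G V n) : defect κ f (word G e a) x y q = 0 := by
    suffices hle : gradedPiece G V n ≤ LinearMap.ker (defectOuter κ f x y (word G e a)) from
      hle hq
    rw [gradedPiece_eq_span e, Submodule.span_le]
    rintro _ ⟨b, g, hb, rfl⟩
    exact defect_word_eq_zero hκ (by rwa [ha, hb]) x y g
  suffices hle : gradedPiece G V m ≤ LinearMap.ker ((defectOuter κ f x y).flip q) from hle hp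
  rw [gradedPiece_eq_span e, Submodule.span_le]
  rintro _ ⟨a, g, ha, rfl⟩
  change defect κ f (word G e a * smashOf V g) x y q = 0
  rw [defect_mul_smashOf f hκ]
  have hgq := mul_mem_gradedPiece (smashOf_mem_gradedPiece g) hq
  rw [zero_add] at hgq
  exact hword ha _ _ hgq

theorem respectsBracket_of_respectsDescents (hκ : IsDrinfeld κ)
    (h : ∀ w, RespectsDescents κ f e w) : RespectsBracket κ f := by
  intro p x y q
  suffices houter : defectOuter κ f x y = 0 from LinearMap.congr_fun₂ houter p q
  have hmem (w : List ι) (g : G) : word G e w * smashOf V g ∈ gradedPiece G V (w.length + 0) :=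
    mul_mem_gradedPiece (word_mem_gradedPiece e w) (smashOf_mem_gradedPiece g)
  exact linearMap_ext_word e fun w g => linearMap_ext_word e fun w' g' =>
    defect_eq_zero_of_mem_gradedPiece hκ (fun u _ => h u) (hmem w g) (hmem w' g') x y

theorem exchange_word_eq_of_overlap (hκ : IsDrinfeld κ) {a b : List ι} {x y z : ι} (hxy : y < x)
    (hyz : z < y) (ih : ∀ w, WordLT w (a ++ x :: y :: z :: b) → RespectsDescents κ f e w) (g : G) :
    exchange κ f (word G e a) (e x) (e y) (word G e (z :: b) * smashOf V g) =
      exchange κ f (word G e (a ++ [x])) (e y) (e z) (word G e b * smashOf V g) := by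
  have hyxz : WordLT (a ++ y :: x :: z :: b) (a ++ x :: y :: z :: b) :=
    wordLT_swap a _ hxy
  have hyzx : WordLT (a ++ y :: z :: x :: b) (a ++ x :: y :: z :: b) :=
    .trans (by simpa using wordLT_swap (a ++ [y]) b (hyz.trans hxy)) hyxz
  have hxzy : WordLT (a ++ x :: z :: y :: b) (a ++ x :: y :: z :: b) :=
    by simpa using wordLT_swap (a ++ [x]) b hyz
  have hzxy : WordLT (a ++ z :: x :: y :: b) (a ++ x :: y :: z :: b) :=
    (wordLT_swap a _ (hyz.trans hxy)).trans hxzy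
  have hdyxz := ih _ hyxz (a := a ++ [y]) (b := b) ⟨by simp, hyz.trans hxy⟩ g
  have hdyzx := ih _ hyzx ⟨rfl, hyz⟩ g
  have hdxzy := ih _ hxzy ⟨rfl, hyz.trans hxy⟩ g
  have hdzxy := ih _ hzxy (a := a ++ [z]) (b := b) ⟨by simp, hxy⟩ g
  simp only [word_append, word_cons, word_nil, mul_one, mul_assoc] at hdyxz hdyzx hdxzy hdzxy ⊢
  exact exchange_eq_exchange_of_overlap f hκ hdyxz hdyzx hdxzy hdzxy

theorem exchange_word_eq_of_disjoint (hκ : IsDrinfeld κ) {a m b : List ι} {x y x' y' : ι}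
    (hxy : y < x) (hxy' : y' < x')
    (ih : ∀ w, WordLT w (a ++ x :: y :: (m ++ x' :: y' :: b)) → RespectsDescents κ f e w) (g : G) :
    exchange κ f (word G e a) (e x) (e y) (word G e (m ++ x' :: y' :: b) * smashOf V g) =
      exchange κ f (word G e (a ++ x :: y :: m)) (e x') (e y') (word G e b * smashOf V g) := by
  have hswap : WordLT (a ++ y :: x :: (m ++ x' :: y' :: b)) (a ++ x :: y :: (m ++ x' :: y' :: b)) :=
    wordLT_swap a _ hxy
  have hswap' :
      WordLT (a ++ x :: y :: (m ++ y' :: x' :: b)) (a ++ x :: y :: (m ++ x' :: y' :: b)) := by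
    simpa using wordLT_swap (a ++ x :: y :: m) b hxy'
  have hyx := ih _ hswap (a := a ++ y :: x :: m) (b := b) ⟨by simp, hxy'⟩ g
  have hyx' := ih _ hswap' ⟨rfl, hxy⟩ g
  have hlow {i j : ℕ} (hij : i + j < a.length + m.length + b.length + 2) {p q : SmashTensor G V}
      (hp : p ∈ gradedPiece G V i) (hq : q ∈ gradedPiece G V j) (u v : V) :
      defect κ f p u v q = 0 :=
    defect_eq_zero_of_mem_gradedPiece hκ (fun w hw => ih w (wordLT_of_length_lt (by
      simp only [List.length_append, List.length_cons]; omega))) hp hq u v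
  have hmul (u v : List ι) (s : G) :
      word G e u * smashOf V s * word G e v ∈ gradedPiece G V (u.length + 0 + v.length) :=
    mul_mem_gradedPiece (mul_mem_gradedPiece (word_mem_gradedPiece e u)
      (smashOf_mem_gradedPiece s)) (word_mem_gradedPiece e v)
  have hleft (s : G) := hlow (by omega) (hmul a m s)
    (mul_mem_gradedPiece (word_mem_gradedPiece e b) (smashOf_mem_gradedPiece g)) (e x') (e y')
  have hright (s : G) := hlow (by omega) (word_mem_gradedPiece e a)
    (mul_mem_gradedPiece (hmul m b s) (smashOf_mem_gradedPiece g)) (e x) (e y)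
  have h := exchange_eq_exchange_of_disjoint (κ := κ) f (p := word G e a) (m := word G e m)
    (q := word G e b * smashOf V g) (x := e x) (y := e y) (x' := e x') (y' := e y')
  simp only [word_append, word_cons, ← mul_assoc] at h hyx hyx' hleft hright ⊢
  exact h hleft hright hyx hyx'

theorem respectsDescents_of_exchange_eq (hκ : IsDrinfeld κ) {w : List ι}
    (ih : ∀ w', WordLT w' w → RespectsDescents κ f e w')
    (hw : ¬ w.SortedLE → ∃ a x y b, IsDescent w a x y b ∧ ∀ g, f (word G e w * smashOf V g) =
      exchange κ f (word G e a) (e x) (e y) (word G e b * smashOf V g)) :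
    RespectsDescents κ f e w := by
  intro a x y b h g
  obtain ⟨a', x', y', b', h', hexchange⟩ := hw h.not_sortedLE
  have heq := IsDescent.eq_of_overlap_of_disjoint
    (E := fun a x y b => exchange κ f (word G e a) (e x) (e y) (word G e b * smashOf V g))
    (fun a x y z b hw hxy hyz => exchange_word_eq_of_overlap hκ hxy hyz (hw ▸ ih) g)
    (fun a x y m x' y' b hw hxy hxy' => exchange_word_eq_of_disjoint hκ hxy hxy' (hw ▸ ih) g) h h'
  rw [defect, ← word_append_cons_cons_mul, ← h.1, hexchange, heq, sub_self]

variable (e) in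
/-- The existence half of the Poincaré–Birkhoff–Witt theorem. -/
theorem exists_respectsBracket (hκ : IsDrinfeld κ) (v : List ι → G → N) :
    ∃ f : SmashTensor G V →ₗ[ℂ] N, RespectsBracket κ f ∧
      ∀ w : List ι, w.SortedLE → ∀ g, f (word G e w * smashOf V g) = v w g := by
  classical
  choose a x y b hdescent using fun w : List ι => exists_isDescent (w := w)
  obtain ⟨u, hu⟩ := exists_forall_eq_of_wellFounded (wordLT_wellFounded (ι := ι))
    (fun u w => if hw : w.SortedLE then v w else fun g =>
      exchange κ (ofWordValues e u) (word G e (a w hw)) (e (x w hw)) (e (y w hw))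
        (word G e (b w hw) * smashOf V g))
    fun u u' w h => by
      split_ifs with hw
      · rfl
      · refine funext fun g => exchange_congr (hdescent w hw).2 (fun w' hw' g => ?_) g
        rw [← (hdescent w hw).1] at hw'
        rw [ofWordValues_word_mul, ofWordValues_word_mul, h w' hw']
  refine ⟨ofWordValues e u, respectsBracket_of_respectsDescents (e := e) hκ fun w => ?_,
    fun w hw g => by rw [ofWordValues_word_mul, hu, dif_pos hw]⟩
  refine wordLT_wellFounded.induction w fun w ih => respectsDescents_of_exchange_eq hκ ih fun hw =>
    ⟨_, _, _, _, hdescent w hw, fun g => ?_⟩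
  rw [ofWordValues_word_mul, hu, dif_neg hw]

end Words

end Bracket

section Lift

variable {G V M : Type*} {ℓ : ℕ} [Group G] [Fintype G] [AddCommGroup V] [Module ℂ V]
  [DistribMulAction G V] [SMulCommClass G ℂ V] [AddCommGroup M] [Module ℂ M]
  {κ : G → V →ₗ[ℂ] V →ₗ[ℂ] FormalRing ℂ ℓ}

variable (κ) in
/-- The constant terms of a bracket with values in `ℂ[[ħ₁, …, ħ_ℓ]]`. -/
def constantBracket (s : G) : V →ₗ[ℂ] V →ₗ[ℂ] ℂ :=
  (κ s).compr₂ (MvPowerSeries.coeff 0)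

theorem RespectsBracket.constantCoeff {θ : SmashTensor G V →ₗ[ℂ] FormalSeries ℓ M}
    (hθ : RespectsBracket κ θ) :
    RespectsBracket (constantBracket κ) (FormalSeries.coeffHom ℂ 0 ∘ₗ θ) := by
  intro p x y q
  have h := congr_arg (FormalSeries.coeffHom ℂ 0) (hθ p x y q)
  simpa [defect, exchange, correction, constantBracket, FormalSeries.coeffHom_zero_smul] using h

/-- The values of the lift on products of sorted words and group elements may be taken constant
in `ħ`; its constant term then agrees with `π` on these, hence everywhere. -/
theorem exists_respectsBracket_coeff_zero_eq (hκ : IsDrinfeld κ) {π : SmashTensor G V →ₗ[ℂ] M}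
    (hπ : RespectsBracket (constantBracket κ) π) :
    ∃ θ : SmashTensor G V →ₗ[ℂ] FormalSeries ℓ M, RespectsBracket κ θ ∧
      ∀ z, FormalSeries.coeff 0 (θ z) = π z := by
  let e := Module.Basis.ofVectorSpace ℂ V
  obtain ⟨_, _⟩ := exists_wellFoundedLT (Module.Basis.ofVectorSpaceIndex ℂ V)
  let const (m : M) : FormalSeries ℓ M := Pi.single 0 m
  obtain ⟨θ, hθ, hsorted⟩ := exists_respectsBracket e hκ fun w g =>
    const (π (word G e w * smashOf V g))
  refine ⟨θ, hθ, LinearMap.congr_fun (hθ.constantCoeff.ext (e := e) hπ fun w hw g => ?_)⟩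
  rw [LinearMap.comp_apply, hsorted w hw]
  exact Pi.single_eq_same (M := fun _ => M) (0 : Fin ℓ →₀ ℕ) _

end Lift

/-! ### Deformations of `G ⋉ Weyl(V)` -/

section Weyl

theorem mem_of_weylMk_eq_zero {V : Type*} [AddCommGroup V] [Module ℂ V]
    {ω : LinearMap.BilinForm ℂ V} {I : TwoSidedIdeal (TensorAlgebra ℂ V)}
    (hI : ∀ a b, WeylRel ω a b → a - b ∈ I) {a : TensorAlgebra ℂ V} (ha : Weyl.mk ω a = 0) :
    a ∈ I := by
  have hrel : ∀ ⦃a b⦄, WeylRel ω a b → I.ringCon.mk' a = I.ringCon.mk' b := fun a b h =>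
    (RingCon.eq I.ringCon).mpr ((I.rel_iff _ _).mpr (hI a b h))
  have hmk : I.ringCon.mk' a = RingQuot.lift ⟨I.ringCon.mk', hrel⟩ (Weyl.mk ω a) := by
    rw [← RingQuot.lift_mkRingHom_apply I.ringCon.mk' hrel, ← RingQuot.mkAlgHom_coe ℂ]
    rfl
  rw [ha, map_zero, ← map_zero I.ringCon.mk'] at hmk
  exact (RingCon.eq I.ringCon).mp hmk

variable {G V : Type*} [Group G] [AddCommGroup V] [Module ℂ V]
  [DistribMulAction G V] [SMulCommClass G ℂ V] (ω : LinearMap.BilinForm ℂ V) [PreservesForm G ω]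

variable (G) in
/-- The quotient map `G ⋉ T(V) → G ⋉ Weyl(V)`. -/
def smashProj : SmashTensor G V →ₐ[ℂ] SmashWeyl G ω :=
  SkewMonoidAlgebra.liftNCAlgHom
    (({ SkewMonoidAlgebra.singleOneRingHom with commutes' _ := rfl } :
      Weyl ω →ₐ[ℂ] SmashWeyl G ω).comp (Weyl.mk ω))
    (SkewMonoidAlgebra.of (Weyl ω) G) (by
      intro a g
      have h : g • Weyl.mk ω a = Weyl.mk ω (g • a) := weylMap_mk G ω g a
      simp [SkewMonoidAlgebra.singleOneRingHom, SkewMonoidAlgebra.single_mul_single, h,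
        -RingQuot.mkAlgHom_coe])

theorem smashProj_single (g : G) (a : TensorAlgebra ℂ V) :
    smashProj G ω (SkewMonoidAlgebra.single g a) = SkewMonoidAlgebra.single g (Weyl.mk ω a) := by
  simp [smashProj, SkewMonoidAlgebra.liftNCAlgHom, SkewMonoidAlgebra.liftNCRingHom,
    SkewMonoidAlgebra.singleOneRingHom, SkewMonoidAlgebra.single_mul_single,
    -RingQuot.mkAlgHom_coe]

theorem coeff_smashProj (z : SmashTensor G V) (g : G) :
    (smashProj G ω z).coeff g = Weyl.mk ω (z.coeff g) := by
  classical
  induction z using SkewMonoidAlgebra.induction_on with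
  | zero => simp
  | add z z' h h' => simp [h, h']
  | single h a =>
    rw [smashProj_single, SkewMonoidAlgebra.coeff_single_apply,
      SkewMonoidAlgebra.coeff_single_apply]
    split_ifs <;> simp

theorem smashProj_surjective : Function.Surjective (smashProj G ω) := fun z => by
  induction z using SkewMonoidAlgebra.induction_on with
  | zero => exact ⟨0, map_zero _⟩
  | add z z' h h' =>
    obtain ⟨y, rfl⟩ := h
    obtain ⟨y', rfl⟩ := h'
    exact ⟨y + y', map_add _ _ _⟩
  | single g a =>
    obtain ⟨a, rfl⟩ := RingQuot.mkAlgHom_surjective ℂ (WeylRel ω) a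
    exact ⟨SkewMonoidAlgebra.single g a, smashProj_single ω g a⟩

theorem smashProj_smashι_mul_smashι (x y : V) :
    smashProj G ω (smashι G x * smashι G y) =
      smashProj G ω (smashι G y * smashι G x) + algebraMap ℂ _ (ω x y) := by
  have h := RingQuot.mkAlgHom_rel ℂ (WeylRel.comm (ω := ω) x y)
  rw [map_sub, AlgHom.commutes, sub_eq_iff_eq_add'] at h
  simp only [smashι_apply, SkewMonoidAlgebra.single_mul_single, one_smul, mul_one,
    smashProj_single, h, SkewMonoidAlgebra.single_add]
  rfl

variable {ω}

theorem mem_of_smashProj_eq_zero {I : TwoSidedIdeal (SmashTensor G V)}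
    (hI : ∀ x y, smashι G x * smashι G y - smashι G y * smashι G x - algebraMap ℂ _ (ω x y) ∈ I)
    {z : SmashTensor G V} (hz : smashProj G ω z = 0) : z ∈ I := by
  have hrel : ∀ a b, WeylRel ω a b → a - b ∈ I.comap SkewMonoidAlgebra.singleOneRingHom := by
    rintro _ _ ⟨x, y⟩
    rw [TwoSidedIdeal.mem_comap, map_sub, map_sub, map_mul, map_mul]
    exact hI x y
  have hcoeff (g : G) : SkewMonoidAlgebra.single 1 (z.coeff g) ∈ I := by
    refine (TwoSidedIdeal.mem_comap _).mp (mem_of_weylMk_eq_zero hrel ?_)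
    rw [← coeff_smashProj, hz, SkewMonoidAlgebra.coeff_zero, Finsupp.zero_apply]
  rw [← z.sum_single, SkewMonoidAlgebra.sum_def]
  refine sum_mem fun g _ => ?_
  simpa [SkewMonoidAlgebra.single_mul_single] using I.mul_mem_right _ (smashOf V g) (hcoeff g)

end Weyl

section Drinfeld

variable {G V M : Type*} {ℓ : ℕ} [Group G] [Fintype G] [AddCommGroup V] [Module ℂ V]
  [DistribMulAction G V] [SMulCommClass G ℂ V] [AddCommGroup M] [Module ℂ M]
  (κ : G → V →ₗ[ℂ] V →ₗ[ℂ] FormalRing ℂ ℓ)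

/-- The elements `x y - y x - ∑_s κ_s(x, y) s` of `(G ⋉ T(V))[[ħ₁, …, ħ_ℓ]]`, for
`x, y ∈ V`. -/
def bracketRelations : Set (MvPowerSeries (Fin ℓ) (SmashTensor G V)) :=
  Set.range fun p : V × V =>
    vec G ℓ p.1 * vec G ℓ p.2 - vec G ℓ p.2 * vec G ℓ p.1 - ∑ s, κ s p.1 p.2 • grp V ℓ s

variable {κ}

theorem extend_C_mul_mul_C_eq_zero {θ : SmashTensor G V →ₗ[ℂ] FormalSeries ℓ M}
    (hθ : RespectsBracket κ θ) {r : MvPowerSeries (Fin ℓ) (SmashTensor G V)}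
    (hr : r ∈ bracketRelations κ) (p q : SmashTensor G V) :
    extend θ (MvPowerSeries.C p * r * MvPowerSeries.C q) = 0 := by
  obtain ⟨⟨x, y⟩, rfl⟩ := hr
  have h := hθ p x y q
  simp only [defect, exchange, correction, ← extend_C, ← map_smul, ← map_sum, ← map_add,
    ← map_sub] at h
  rw [← h]
  congr 1
  simp only [vec, grp, smashι_apply, SkewMonoidAlgebra.of_apply, map_mul, mul_sub, sub_mul,
    mul_add, add_mul, Finset.mul_sum, Finset.sum_mul, mul_smul_comm, smul_mul_assoc, mul_assoc,
    sub_sub]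

theorem constantCoeff_bracketRelation (x y : V) :
    MvPowerSeries.constantCoeff (vec G ℓ x * vec G ℓ y - vec G ℓ y * vec G ℓ x -
      ∑ s, κ s x y • grp V ℓ s) =
      smashι G x * smashι G y - smashι G y * smashι G x -
        ∑ s, constantBracket κ s x y • smashOf V s := by
  simp [vec, grp, constantBracket, smashι_apply, Algebra.smul_def (A := MvPowerSeries _ _),
    constantCoeff_algebraMap, Algebra.smul_def (A := SmashTensor G V)]

end Drinfeld

section FlatDeformation

variable {G V : Type*} {ℓ : ℕ} [Group G] [Fintype G] [DecidableEq G] [AddCommGroup V] [Module ℂ V]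
  [DistribMulAction G V] [SMulCommClass G ℂ V] {ω : LinearMap.BilinForm ℂ V} [PreservesForm G ω]
  {κ : G → V →ₗ[ℂ] V →ₗ[ℂ] FormalRing ℂ ℓ}

theorem smashProj_respectsBracket :
    RespectsBracket (K := ℂ) (N := SmashWeyl G ω) (Pi.single 1 ω)
      (smashProj G ω).toLinearMap := by
  intro p x y q
  have hsum : correction (Pi.single (1 : G) ω) (smashProj G ω).toLinearMap p x y q =
      ω x y • smashProj G ω (p * q) := by
    rw [correction, Finset.sum_eq_single 1 (fun s _ hs => by simp [hs]) (by simp)]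
    simp
  have hmul : smashProj G ω (p * smashι G x * smashι G y * q) =
      smashProj G ω (p * smashι G y * smashι G x * q) + ω x y • smashProj G ω (p * q) := by
    rw [mul_assoc p (smashι G x), mul_assoc p (smashι G y), map_mul, map_mul,
      smashProj_smashι_mul_smashι, Algebra.algebraMap_eq_smul_one, mul_add, add_mul,
      mul_smul_comm, mul_one, smul_mul_assoc, ← map_mul (smashProj G ω),
      ← map_mul (smashProj G ω), ← map_mul (smashProj G ω)]
  rw [defect, exchange, hsum]
  exact sub_eq_zero.mpr hmul

theorem exists_mem_closedIdeal_of_smashProj_eq_zero (hκ : constantBracket κ = Pi.single 1 ω)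
    {z : SmashTensor G V} (hz : smashProj G ω z = 0) :
    ∃ y ∈ closedIdeal (bracketRelations κ), MvPowerSeries.constantCoeff y = z := by
  refine mem_constantTerms.mp (mem_of_smashProj_eq_zero (fun x y => ?_) hz)
  refine mem_constantTerms.mpr ⟨_, subset_closedIdeal _ ⟨(x, y), rfl⟩, ?_⟩
  have hsum : ∑ s, constantBracket κ s x y • smashOf V s = algebraMap ℂ _ (ω x y) := by
    rw [hκ, Finset.sum_eq_single 1 (fun s _ hs => by simp [hs]) (by simp), map_one,
      Pi.single_eq_same, Algebra.algebraMap_eq_smul_one]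
  rw [constantCoeff_bracketRelation, hsum]

theorem IsDrinfeld.exists_flatFormalDeformation (hκ : IsDrinfeld κ)
    (hκ₀ : constantBracket κ = Pi.single 1 ω) :
    ∃ D : FlatFormalDeformation ℂ ℓ (SmashWeyl G ω)
        (MvPowerSeries (Fin ℓ) (SmashTensor G V) ⧸ (closedIdeal (bracketRelations κ)).asIdeal),
      ∀ x, D.φ (Ideal.Quotient.mk _ (Ideal.Quotient.mk _ x)) =
        smashProj G ω (MvPowerSeries.constantCoeff x) := by
  obtain ⟨θ, hθ, hθ₀⟩ := exists_respectsBracket_coeff_zero_eq hκ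
    (hκ₀ ▸ smashProj_respectsBracket (ω := ω))
  exact FormalDeformation.exists_flatFormalDeformation (smashProj_surjective ω) hθ₀
    (isAdicallyClosed_closedIdeal _)
    (fun _ => extend_eq_zero_of_mem_closedIdeal fun _ => extend_C_mul_mul_C_eq_zero hθ)
    fun _ => exists_mem_closedIdeal_of_smashProj_eq_zero hκ₀

end FlatDeformation

/-! ### The bracket of the symplectic reflection algebra -/

theorem jacobi_of_finrank_eq_two {k W : Type*} [Field k] [AddCommGroup W] [Module k W]
    (hW : Module.finrank k W = 2) {β : LinearMap.BilinForm k W} (hβ : β.IsAlt) (x y z : W) :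
    β x y • z + β y z • x + β z x • y = 0 := by
  have : FiniteDimensional k W := Module.finite_of_finrank_pos (by lia)
  let e := Module.finBasisOfFinrankEq k W hW
  have hβ₁₀ : β (e 1) (e 0) = -β (e 0) (e 1) := (hβ.neg_eq _ _).symm
  rw [← e.sum_repr x, ← e.sum_repr y, ← e.sum_repr z]
  simp only [Fin.sum_univ_two, map_add, map_smul, LinearMap.add_apply, LinearMap.smul_apply,
    smul_eq_mul, hβ _, hβ₁₀]
  module

section Reflections

variable {G V : Type*} [Group G] [AddCommGroup V] [Module ℂ V]
  [DistribMulAction G V] [SMulCommClass G ℂ V]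

theorem one_notMem_reflections : (1 : G) ∉ reflections G V := by
  have h : act V (1 : G) = 1 := LinearMap.ext fun x => one_smul G x
  change Module.finrank ℂ (LinearMap.range (1 - act V (1 : G))) ≠ 2
  rw [h, sub_self, LinearMap.range_zero, finrank_bot]
  norm_num

theorem conj_mem_reflections_iff (g s : G) :
    g * s * g⁻¹ ∈ reflections G V ↔ s ∈ reflections G V := by
  let e : V ≃ₗ[ℂ] V := DistribMulAction.toLinearEquiv ℂ V g
  have h : LinearMap.range (1 - act V (g * s * g⁻¹)) =
      (LinearMap.range (1 - act V s)).map e.toLinearMap := by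
    rw [← LinearMap.range_comp]
    have : (1 - act V (g * s * g⁻¹)) ∘ₗ e.toLinearMap = e.toLinearMap ∘ₗ (1 - act V s) := by
      ext x
      change g • x - (g * s * g⁻¹) • g • x = g • (x - s • x)
      rw [smul_smul, inv_mul_cancel_right, mul_smul, smul_sub]
    rw [← this, LinearMap.range_comp_of_range_eq_top _ e.range]
  change Module.finrank ℂ _ = 2 ↔ Module.finrank ℂ _ = 2
  rw [h, e.finrank_map_eq]

variable [Finite G] [FiniteDimensional ℂ V]

variable (V) in
/-- The projection to the image of `1 - s` along its kernel. -/
abbrev reflProj (s : G) : V →ₗ[ℂ] V :=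
  Submodule.projection _ _ (isCompl_range_ker V s)

theorem reflProj_mem (s : G) (x : V) : reflProj V s x ∈ LinearMap.range (1 - act V s) :=
  Submodule.projection_apply_mem _ x

theorem smul_reflProj_sub (s : G) (x : V) : s • reflProj V s x - reflProj V s x = s • x - x := by
  have h : x - reflProj V s x ∈ LinearMap.ker (1 - act V s) := by
    rw [← Submodule.ker_projection (isCompl_range_ker V s), LinearMap.mem_ker, map_sub,
      Submodule.projection_apply_of_mem_left _ (reflProj_mem s x), sub_self]
  have hfix : x - reflProj V s x - s • (x - reflProj V s x) = 0 := h
  rw [← sub_eq_zero, ← hfix, smul_sub]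
  abel

theorem reflProj_eq_of_mem_of_smul_sub_eq {s : G} {x u : V}
    (hu : u ∈ LinearMap.range (1 - act V s)) (hx : s • u - u = s • x - x) :
    reflProj V s x = u := by
  have hker : x - u ∈ LinearMap.ker (1 - act V s) := by
    change x - u - s • (x - u) = 0
    rw [← sub_eq_zero.mpr hx, smul_sub]
    abel
  rw [← Submodule.ker_projection (isCompl_range_ker V s), LinearMap.mem_ker, map_sub,
    sub_eq_zero] at hker
  exact hker.trans (Submodule.projection_apply_of_mem_left _ hu)

theorem reflProj_conj (g s : G) (x : V) :
    reflProj V (g * s * g⁻¹) (g • x) = g • reflProj V s x := by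
  refine reflProj_eq_of_mem_of_smul_sub_eq ?_ ?_
  · obtain ⟨v, hv⟩ := reflProj_mem s x
    refine ⟨g • v, ?_⟩
    rw [← hv]
    change g • v - (g * s * g⁻¹) • g • v = g • (v - s • v)
    rw [smul_smul, inv_mul_cancel_right, mul_smul, smul_sub]
  · rw [smul_smul, smul_smul, inv_mul_cancel_right, mul_smul, mul_smul, ← smul_sub, ← smul_sub,
      smul_reflProj_sub]

variable {ω : LinearMap.BilinForm ℂ V}

theorem reflForm_conj [PreservesForm G ω] (g s : G) (x y : V) :
    reflForm ω (g * s * g⁻¹) (g • x) (g • y) = reflForm ω s x y := by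
  change ω (reflProj V _ _) (reflProj V _ _) = ω (reflProj V s x) (reflProj V s y)
  rw [reflProj_conj, reflProj_conj, PreservesForm.apply_smul_smul]

/-- Only the components in the plane `Im (1 - s)` enter, so this is the Jacobi identity there. -/
theorem reflForm_jacobi (hω : ω.IsAlt) {s : G} (hs : s ∈ reflections G V) (x y z : V) :
    reflForm ω s x y • (s • z - z) + reflForm ω s y z • (s • x - x) +
      reflForm ω s z x • (s • y - y) = 0 := by
  let p (v : V) : LinearMap.range (1 - act V s) := ⟨reflProj V s v, reflProj_mem s v⟩
  have h := jacobi_of_finrank_eq_two hs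
    (β := ω.restrict (LinearMap.range (1 - act V s))) (fun v => hω v) (p x) (p y) (p z)
  have h' := congrArg ((act V s - 1) ∘ₗ Submodule.subtype _) h
  rw [map_add, map_add, map_smul, map_smul, map_smul, map_zero] at h'
  rw [← smul_reflProj_sub s x, ← smul_reflProj_sub s y, ← smul_reflProj_sub s z]
  exact h'

section Curvature

variable {ℓ : ℕ} {t : FormalRing ℂ ℓ} {c : reflections G V → FormalRing ℂ ℓ}

variable (ω t c) in
open Classical in
/-- The bracket `κ(x, y) = t ω(x, y) - 2 ∑_{s ∈ S} c_s ω_s(x, y) s` of the relations of the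
symplectic reflection algebra, as a family of bilinear maps indexed by `G`. -/
def curvature (s : G) : V →ₗ[ℂ] V →ₗ[ℂ] FormalRing ℂ ℓ :=
  if s = 1 then ω.compr₂ (LinearMap.toSpanSingleton ℂ _ t)
  else if hs : s ∈ reflections G V then
    (ω.compl₁₂ (reflProj V s) (reflProj V s)).compr₂
      (LinearMap.toSpanSingleton ℂ _ (-2 * c ⟨s, hs⟩))
  else 0

theorem curvature_one (x y : V) : curvature ω t c (1 : G) x y = ω x y • t := by
  rw [curvature, if_pos rfl]
  rfl

theorem curvature_of_mem {s : G} (hs : s ∈ reflections G V) (x y : V) :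
    curvature ω t c s x y = reflForm ω s x y • (-2 * c ⟨s, hs⟩) := by
  rw [curvature, if_neg (ne_of_mem_of_not_mem hs one_notMem_reflections), dif_pos hs]
  rfl

theorem curvature_of_notMem {s : G} (h1 : s ≠ 1) (hs : s ∉ reflections G V) :
    curvature ω t c s = 0 := by
  rw [curvature, if_neg h1, dif_neg hs]

theorem curvature_conj [PreservesForm G ω]
    (hc : ∀ (g : G) (s s' : reflections G V), (s' : G) = g * s * g⁻¹ → c s' = c s)
    (g s : G) (x y : V) :
    curvature ω t c (g * s * g⁻¹) (g • x) (g • y) = curvature ω t c s x y := by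
  by_cases h1 : s = 1
  · rw [h1, mul_one, mul_inv_cancel, curvature_one, curvature_one, PreservesForm.apply_smul_smul]
  by_cases hs : s ∈ reflections G V
  · have hs' := (conj_mem_reflections_iff g s).mpr hs
    rw [curvature_of_mem hs, curvature_of_mem hs', reflForm_conj, hc g ⟨s, hs⟩ ⟨_, hs'⟩ rfl]
  · rw [curvature_of_notMem h1 hs, curvature_of_notMem (mt conj_eq_one_iff.mp h1)
      (mt (conj_mem_reflections_iff g s).mp hs)]
    rfl

theorem isDrinfeld_curvature [PreservesForm G ω] (hω : ω.IsAlt)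
    (hc : ∀ (g : G) (s s' : reflections G V), (s' : G) = g * s * g⁻¹ → c s' = c s) :
    IsDrinfeld (curvature ω t c) where
  alt s x := by
    by_cases h1 : s = 1
    · rw [h1, curvature_one, hω, zero_smul]
    by_cases hs : s ∈ reflections G V
    · rw [curvature_of_mem hs, reflForm, hω, zero_smul]
    · rw [curvature_of_notMem h1 hs]
      rfl
  conj := curvature_conj hc
  jacobi s x y z := by
    by_cases h1 : s = 1
    · simp [h1]
    by_cases hs : s ∈ reflections G V
    · simp only [curvature_of_mem hs, TensorProduct.smul_tmul, ← TensorProduct.tmul_add,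
        reflForm_jacobi hω hs, TensorProduct.tmul_zero]
    · simp [curvature_of_notMem h1 hs]

theorem constantBracket_curvature [DecidableEq G] (ht : MvPowerSeries.constantCoeff t = 1)
    (hc : ∀ s, MvPowerSeries.constantCoeff (c s) = 0) :
    constantBracket (curvature ω t c) = Pi.single (1 : G) ω := by
  funext s
  by_cases h1 : s = 1
  · subst h1
    ext x y
    simp [constantBracket, curvature_one, ht]
  rw [Pi.single_eq_of_ne h1]
  by_cases hs : s ∈ reflections G V
  · ext x y
    simp [constantBracket, curvature_of_mem hs, hc]
  · rw [constantBracket, curvature_of_notMem h1 hs]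
    rfl

end Curvature

end Reflections

section Relations

variable {G V : Type*} [Group G] [Fintype G] [AddCommGroup V] [Module ℂ V] [FiniteDimensional ℂ V]
  [DistribMulAction G V] [SMulCommClass G ℂ V] {ω : LinearMap.BilinForm ℂ V}
  {ℓ : ℕ} {t : FormalRing ℂ ℓ} {c : reflections G V → FormalRing ℂ ℓ}

theorem sum_curvature_smul {N : Type*} [AddCommGroup N] [Module (FormalRing ℂ ℓ) N] (x y : V)
    (n : G → N) :
    ∑ s, curvature ω t c s x y • n s =
      (ω x y • t) • n 1 + ∑ s : reflections G V, (reflForm ω (s : G) x y • (-2 * c s)) • n s := by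
  classical
  rw [← Finset.add_sum_erase _ _ (Finset.mem_univ 1), curvature_one]
  have hmem (s : reflections G V) : reflForm ω (s : G) x y • (-2 * c s) =
      curvature ω t c (s : G) x y := (curvature_of_mem s.2 x y).symm
  simp only [hmem]
  rw [Finset.sum_set_coe (reflections G V) (f := fun s => curvature ω t c s x y • n s)]
  refine congrArg _ (Finset.sum_subset (fun s hs => ?_) fun s hs hs' => ?_).symm
  · exact Finset.mem_erase.mpr
      ⟨ne_of_mem_of_not_mem (Set.mem_toFinset.mp hs) one_notMem_reflections, Finset.mem_univ s⟩
  · rw [curvature_of_notMem (Finset.ne_of_mem_erase hs) (mt Set.mem_toFinset.mpr hs')]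
    exact zero_smul _ _

theorem relations_eq_bracketRelations :
    relations ω t c = bracketRelations (curvature ω t c) := by
  have hkappa (x y : V) : kappa ω t c x y = ∑ s, curvature ω t c s x y • grp V ℓ s := by
    have hsum := sum_curvature_smul (ω := ω) (t := t) (c := c) x y (grp V ℓ)
    rw [hsum, kappa, sub_eq_add_neg, Finset.mul_sum, ← Finset.sum_neg_distrib]
    congr 1
    · rw [Algebra.algebraMap_eq_smul_one, smul_comm, smul_assoc]
      rfl
    · refine Finset.sum_congr rfl fun s _ => ?_
      rw [smul_assoc, Algebra.smul_def (c s), Algebra.smul_def (_ * c s), map_mul, map_neg,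
        map_ofNat, mul_assoc, ← mul_smul_comm, ← mul_smul_comm]
      exact neg_mul_eq_neg_mul _ _
  simp only [relations, bracketRelations, hkappa]

end Relations

section FormalParam

variable {G V : Type*} [Group G] [AddCommGroup V] [Module ℂ V]
  [DistribMulAction G V] [SMulCommClass G ℂ V] {ℓ : ℕ}
  (b : Module.Basis (Fin ℓ) ℂ (invariantFunctions G V))

theorem constantCoeff_formalParam (s : reflections G V) :
    MvPowerSeries.constantCoeff (formalParam b s) = 0 := by
  simp [formalParam, MvPowerSeries.constantCoeff_smul]

theorem formalParam_conj (g : G) (s s' : reflections G V) (h : (s' : G) = g * s * g⁻¹) :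
    formalParam b s' = formalParam b s :=
  Finset.sum_congr rfl fun i _ => by rw [(b i).2 g s s' h]

end FormalParam

end SymplecticReflection

end

theorem mainTheorem2_general {V G : Type*} [AddCommGroup V] [Module ℂ V] [FiniteDimensional ℂ V]
    [Group G] [Finite G] [DistribMulAction G V] [SMulCommClass G ℂ V]
    (ω : LinearMap.BilinForm ℂ V) (hω_alt : ω.IsAlt) [SymplecticReflection.PreservesForm G ω]
    {ℓ : ℕ} {t : FormalDeformation.FormalRing ℂ ℓ}
    {c : SymplecticReflection.reflections G V → FormalDeformation.FormalRing ℂ ℓ}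
    (ht : MvPowerSeries.constantCoeff t = 1) (hc : ∀ s, MvPowerSeries.constantCoeff (c s) = 0)
    (hc_conj : ∀ (g : G) (s s' : SymplecticReflection.reflections G V),
      (s' : G) = g * s * g⁻¹ → c s' = c s) :
    ∃ D : FormalDeformation.FlatFormalDeformation ℂ ℓ (SymplecticReflection.SmashWeyl G ω)
        (MvPowerSeries (Fin ℓ) (SymplecticReflection.SmashTensor G V) ⧸
          (FormalDeformation.closedIdeal (SymplecticReflection.relations ω t c)).asIdeal),
      (∀ x : V,
        D.φ (Ideal.Quotient.mk _ (Ideal.Quotient.mk _ (SymplecticReflection.vec G ℓ x))) =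
        SkewMonoidAlgebra.single 1 (SymplecticReflection.Weyl.mk ω (TensorAlgebra.ι ℂ x))) ∧
      (∀ g : G,
        D.φ (Ideal.Quotient.mk _ (Ideal.Quotient.mk _ (SymplecticReflection.grp V ℓ g))) =
        SkewMonoidAlgebra.single g 1) := by
  classical
  have := Fintype.ofFinite G
  rw [SymplecticReflection.relations_eq_bracketRelations]
  obtain ⟨D, hD⟩ := (SymplecticReflection.isDrinfeld_curvature hω_alt hc_conj)
    |>.exists_flatFormalDeformation (SymplecticReflection.constantBracket_curvature ht hc)
  refine ⟨D, fun x => ?_, fun g => ?_⟩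
  · rw [hD, SymplecticReflection.vec, MvPowerSeries.constantCoeff_C,
      SymplecticReflection.smashProj_single]
  · rw [hD, SymplecticReflection.grp, MvPowerSeries.constantCoeff_C,
      SymplecticReflection.smashProj_single, map_one]

theorem mainTheorem2 {V G : Type*} [AddCommGroup V] [Module ℂ V] [FiniteDimensional ℂ V]
    [Group G] [Finite G] [DistribMulAction G V] [SMulCommClass G ℂ V]
    (ω : LinearMap.BilinForm ℂ V) (hω_alt : ω.IsAlt) (hω_nondeg : ω.Nondegenerate)
    [SymplecticReflection.PreservesForm G ω]
    {ℓ : ℕ} (b : Module.Basis (Fin ℓ) ℂ (SymplecticReflection.invariantFunctions G V)) :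
    ∃ D : FormalDeformation.FlatFormalDeformation ℂ ℓ
        (SymplecticReflection.SmashWeyl G ω) (SymplecticReflection.FormalSRA ω b),
      (∀ x : V,
        D.φ (Ideal.Quotient.mk _
          (SymplecticReflection.FormalSRA.mk ω b (SymplecticReflection.vec G ℓ x))) =
        SkewMonoidAlgebra.single 1 (SymplecticReflection.Weyl.mk ω (TensorAlgebra.ι ℂ x))) ∧
      (∀ g : G,
        D.φ (Ideal.Quotient.mk _
          (SymplecticReflection.FormalSRA.mk ω b (SymplecticReflection.grp V ℓ g))) =
        SkewMonoidAlgebra.single g 1) :=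
  mainTheorem2_general ω hω_alt (map_one _) (SymplecticReflection.constantCoeff_formalParam b)
    (SymplecticReflection.formalParam_conj b)
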